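/- Let $(M,g)$ be a smooth connected Riemannian $3$-manifold with boundary, $k$ a smooth symmetric $2$-tensor on $M$, and $\tau(x)=\mathrm{dist}(x,\partial M)$. For functions $\phi,f$ set $$\mathcal J_\phi(f)=H(f)-K(f)=\Big(g^{ij}-\frac{\phi^2f^if^j}{1+\phi^2|\nabla f|^2}\Big)\Big(\frac{\phi\nabla_{ij}f+\phi_if_j+\phi_jf_i}{\sqrt{1+\phi^2|\nabla f|^2}}-k_{ij}\Big),$$ so that $\mathcal J_\phi(f)=0$ is the generalized Jang equation. Let $T>0$ be such that $\{\tau\le T\}$ is compact and $\tau$ is smooth, up to $\partial M$, on $\{\tau<T\}$ (every sufficiently small $T$ has this property if $(M,g)$ is asymptotically flat with compact boundary). Write $S_t=\{\tau=t\}$ and let $\theta_+=H_{S_\tau}+\mathrm{Tr}_{S_\tau}k$ be the null expansion of $S_\tau$ with respect to the unit normal $\nabla\tau$. Let $l,c>0$ and let $b$ be real with $-\frac{l-1}{2}\le b<\frac{l+1}{2}$. Assume that $c^{-1}\tau^l\le\theta_+(S_\tau)\le c\,\tau^l$ for $0\le\tau<T$. Let $\widetilde\phi$ be smooth (up to $\partial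 M$) and strictly positive on $\{\tau<T\}$. For $\delta\ge0$ let $\phi_\delta$ be any function on $M$ that is smooth and strictly positive on $M\setminus\partial M$ and satisfies $\phi_\delta=(\tau+\delta)^b\widetilde\phi$ for $0<\tau<T$. A $\delta$-regularized blow-up solution ($\delta>0$) is a function $f_\delta$, smooth on $M\setminus\partial M$, with $\mathcal J_{\phi_\delta}(f_\delta)=0$ there and $f_\delta(x)\to+\infty$ as $x\to\partial M$. For a function $\psi$ on $(0,\infty)$ put $\psi_\delta(\tau)=\psi(\tau+\delta)$, and for $\alpha>0$, $\beta\in\mathbb R$ let $$\underline\psi(t)=\begin{cases}\alpha\,t^{-b-\frac{l-1}{2}}+\beta,& b>-\frac{l-1}{2},\\ -\alpha\log t+\beta,& b=-\frac{l-1}{2}.\end{cases}$$ (i) For every $\lambda>0$ there is $\alpha_0>0$ such that for every $\alpha\in(0,\alpha_0]$ there is $t_0>0$ for which the following holds for all $\beta\in\mathbb R$, $\delta\ge 0$, $\tau_0\in(0,T)$ with $\tau_0+\delta\le t_0$, and all $\phi_\delta$ as above. The function $\underline\psi_\delta$ is a strict subsolution, $$\mathcal J_{\phi_\delta}(\underline\psi_\delta)\ge\lambda(\tau+\delta)^l>0\quad\text{on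 } 0<\tau\le\tau_0;$$ and if $\delta>0$ and $f_\delta$ is a $\delta$-regularized blow-up solution with $f_\delta\ge\underline\psi_\delta(\tau_0)$ on $S_{\tau_0}$, then $f_\delta\ge\underline\psi_\delta(\tau)$ at all points with $0<\tau\le\tau_0$. (ii) More generally, let $\delta>0$, $\tau_0\in(0,T)$, $\lambda>0$, and let $\psi$ be any $C^2$ function on $(0,\infty)$ with $\mathcal J_{\phi_\delta}(\psi_\delta)\ge\lambda(\tau+\delta)^l$ on $0<\tau\le\tau_0$. If $f_\delta$ is a $\delta$-regularized blow-up solution with $f_\delta\ge\psi_\delta(\tau_0)$ on $S_{\tau_0}$, then $f_\delta\ge\psi_\delta(\tau)$ at all points with $0<\tau\le\tau_0$. -/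

import Mathlib

open scoped Manifold ContDiff Topology Bundle

noncomputable section

namespace Jang

/-- The model vector space `ℝ³`. -/
abbrev E3 : Type := EuclideanSpace ℝ (Fin 3)

/-- The `i`-th standard basis vector of `ℝ³`. -/
def basisVec (i : Fin 3) : E3 := EuclideanSpace.single i 1

/-- The partial derivative `∂ᵢ h` at `u` of a function `h` of local coordinates. It is taken within
the half space of coordinates, so that it also makes sense at boundary points; at interior points
it is the usual partial derivative. -/
def pderiv (i : Fin 3) (h : E3 → ℝ) (u : E3) : ℝ :=
  fderivWithin ℝ h (Set.range (𝓡∂ 3)) u (basisVec i)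

section

variable {M : Type*} [MetricSpace M] [ChartedSpace (EuclideanHalfSpace 3) M]

/-- The coordinates of the point `x` in the preferred chart at `x`. All the coordinate expressions
below are written in this chart. -/
def basePt (x : M) : E3 := extChartAt (𝓡∂ 3) x x

/-- A function on `M`, written in the preferred chart at `x`. -/
def inChart (x : M) (f : M → ℝ) (u : E3) : ℝ := f ((extChartAt (𝓡∂ 3) x).symm u)

/-- The first derivatives `fᵢ = ∂ᵢ f` at `x`, in the preferred chart at `x`. -/
def partialAt (f : M → ℝ) (x : M) (i : Fin 3) : ℝ := pderiv i (inChart x f) (basePt x)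

/-- The coordinate vector field `∂/∂xⁱ` of the preferred chart at `x`, at the point with
coordinates `u`. -/
def coordVec (x : M) (u : E3) (i : Fin 3) :
    TangentSpace (𝓡∂ 3) ((extChartAt (𝓡∂ 3) x).symm u) :=
  mfderivWithin 𝓘(ℝ, E3) (𝓡∂ 3) (extChartAt (𝓡∂ 3) x).symm (Set.range (𝓡∂ 3)) u (basisVec i)

/-- The components `kᵢⱼ` at `x` of a 2-tensor, in the preferred chart at `x`. -/
def tensorAt
    (k : ∀ x : M, TangentSpace (𝓡∂ 3) x →L[ℝ] TangentSpace (𝓡∂ 3) x →L[ℝ] ℝ)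
    (x : M) (i j : Fin 3) : ℝ :=
  k ((extChartAt (𝓡∂ 3) x).symm (basePt x)) (coordVec x (basePt x) i) (coordVec x (basePt x) j)

/-- The distance `τ` to the boundary `∂M`. -/
def tau (x : M) : ℝ := Metric.infDist x ((𝓡∂ 3).boundary M)

variable (M) in
/-- `T` is the width of a smooth collar of the boundary: `{τ ≤ T}` is compact, and `τ` is smooth, up
to the boundary, on `{τ < T}`. -/
structure IsCollarWidth (T : ℝ) : Prop where
  pos : 0 < T
  compact : IsCompact {x : M | tau x ≤ T}
  smooth : ContMDiffOn (𝓡∂ 3) 𝓘(ℝ, ℝ) ∞ (tau : M → ℝ) {x : M | tau x < T}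

/-- `φ` is a warping factor of the form `(τ + δ) ^ b * φt` in the collar `{0 < τ < T}`, arbitrarily
extended, as a smooth and strictly positive function, to `M ∖ ∂M`. The unregularized
warping factor corresponds to `δ = 0`. -/
structure IsWarpingFactor (T b : ℝ) (φt : M → ℝ) (δ : ℝ) (φ : M → ℝ) : Prop where
  smooth : ContMDiffOn (𝓡∂ 3) 𝓘(ℝ, ℝ) ∞ φ ((𝓡∂ 3).interior M)
  pos : ∀ x ∈ (𝓡∂ 3).interior M, 0 < φ x
  eq_collar : ∀ x, 0 < tau x → tau x < T → φ x = (tau x + δ) ^ b * φt x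

variable [Bundle.RiemannianBundle (fun x : M ↦ TangentSpace (𝓡∂ 3) x)]

/-- The components `gᵢⱼ` of the metric in the preferred chart at `x`, as functions of the
coordinates `u`. -/
def metricMat (x : M) (u : E3) : Matrix (Fin 3) (Fin 3) ℝ :=
  Matrix.of fun i j ↦ inner ℝ (coordVec x u i) (coordVec x u j)

/-- The components `gⁱʲ` at `x` of the inverse metric. -/
def invMetric (x : M) : Matrix (Fin 3) (Fin 3) ℝ := (metricMat x (basePt x))⁻¹

/-- The Christoffel symbols `Γᵐᵢⱼ` at `x` of the Levi-Civita connection. -/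
def christoffel (x : M) (m i j : Fin 3) : ℝ :=
  (1 / 2) * ∑ p, invMetric x m p *
    (pderiv i (fun u ↦ metricMat x u j p) (basePt x)
      + pderiv j (fun u ↦ metricMat x u i p) (basePt x)
      - pderiv p (fun u ↦ metricMat x u i j) (basePt x))

/-- The components `∇ᵢⱼ f = ∂ᵢ∂ⱼ f - Γᵐᵢⱼ ∂ₘ f` at `x` of the covariant Hessian. -/
def hessAt (f : M → ℝ) (x : M) (i j : Fin 3) : ℝ :=
  pderiv i (fun u ↦ pderiv j (inChart x f) u) (basePt x)
    - ∑ m, christoffel x m i j * partialAt f x m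

/-- The components `fⁱ = gⁱʲ fⱼ` at `x` of the gradient. -/
def gradAt (f : M → ℝ) (x : M) (i : Fin 3) : ℝ := ∑ j, invMetric x i j * partialAt f x j

/-- `|∇f|²` at `x`. -/
def gradNormSq (f : M → ℝ) (x : M) : ℝ := ∑ i, gradAt f x i * partialAt f x i

/-- The generalized Jang operator `H(f) - K(f)` with warping factor `φ`, at the point `x`:
`(gⁱʲ - φ² fⁱ fʲ / (1 + φ²|∇f|²)) ((φ ∇ᵢⱼf + φᵢ fⱼ + φⱼ fᵢ) / √(1 + φ²|∇f|²) - kᵢⱼ)`. -/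
def jangOp (k : ∀ x : M, TangentSpace (𝓡∂ 3) x →L[ℝ] TangentSpace (𝓡∂ 3) x →L[ℝ] ℝ)
    (φ f : M → ℝ) (x : M) : ℝ :=
  ∑ i, ∑ j,
    (invMetric x i j
      - φ x ^ 2 * gradAt f x i * gradAt f x j / (1 + φ x ^ 2 * gradNormSq f x))
    * ((φ x * hessAt f x i j + partialAt φ x i * partialAt f x j + partialAt φ x j * partialAt f x i)
        / √(1 + φ x ^ 2 * gradNormSq f x)
      - tensorAt k x i j)

/-- The inverse metric `gⁱʲ - nⁱ nʲ` induced on the level sets of `s`, where `n = ∇s / |∇s|`. -/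
def levelInvMetric (s : M → ℝ) (x : M) (i j : Fin 3) : ℝ :=
  invMetric x i j - gradAt s x i * gradAt s x j / gradNormSq s x

/-- The mean curvature at `x` of the level set of `s` through `x`, with respect to the unit normal
`n = ∇s / |∇s|`, with the sign for which `H = div n`. -/
def meanCurvLevel (s : M → ℝ) (x : M) : ℝ :=
  ∑ i, ∑ j, levelInvMetric s x i j * (hessAt s x i j / √(gradNormSq s x))

/-- The null expansion `θ₊ = H + Tr k`, at the point `x`, of the surface through `x` at constant
distance from the boundary. The unit normal is `∇τ`, which points away from the boundary. -/
def thetaPlus (k : ∀ x : M, TangentSpace (𝓡∂ 3) x →L[ℝ] TangentSpace (𝓡∂ 3) x →L[ℝ] ℝ)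
    (x : M) : ℝ :=
  meanCurvLevel tau x + ∑ i, ∑ j, levelInvMetric tau x i j * tensorAt k x i j

/-- `f` is a smooth solution on `M ∖ ∂M` of the generalized Jang equation with warping factor `φ`,
which blows up to `+∞` at the boundary. -/
structure IsBlowUpSolution
    (k : ∀ x : M, TangentSpace (𝓡∂ 3) x →L[ℝ] TangentSpace (𝓡∂ 3) x →L[ℝ] ℝ)
    (φ f : M → ℝ) : Prop where
  smooth : ContMDiffOn (𝓡∂ 3) 𝓘(ℝ, ℝ) ∞ f ((𝓡∂ 3).interior M)
  eqn : ∀ x ∈ (𝓡∂ 3).interior M, jangOp k φ f x = 0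
  blowUp : ∀ p ∈ (𝓡∂ 3).boundary M,
    Filter.Tendsto f (𝓝[(𝓡∂ 3).interior M] p) Filter.atTop

/-- The shifted function `ψ_δ = ψ(τ + δ)` satisfies `H(ψ_δ) - K(ψ_δ) ≥ Λ (τ + δ) ^ l` on
`0 < τ ≤ τ₀`, where `φ` is the warping factor. -/
def IsShiftedSubsolution
    (k : ∀ x : M, TangentSpace (𝓡∂ 3) x →L[ℝ] TangentSpace (𝓡∂ 3) x →L[ℝ] ℝ)
    (φ : M → ℝ) (l Λ δ τ₀ : ℝ) (ψ : ℝ → ℝ) : Prop :=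
  ∀ x : M, 0 < tau x → tau x ≤ τ₀ →
    Λ * (tau x + δ) ^ l ≤ jangOp k φ (fun y ↦ ψ (tau y + δ)) x

end

/-- The profile of the subsolution: `α t ^ (-b - (l - 1) / 2) + β`, or `-α log t + β` in the
borderline case `b = -(l - 1) / 2`. -/
def profile (b l α β t : ℝ) : ℝ :=
  if b = -(l - 1) / 2 then -α * Real.log t + β else α * t ^ (-b - (l - 1) / 2) + β

end Jang

end

set_option linter.unusedSectionVars false

/-! Write `t = τ + δ`. Wherever `0 < τ < T` one has `|∇τ| = 1`, hence `Hess τ (∇τ, ∇τ) = 0`, and the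
Jang operator on `ψ(τ + δ)` reduces to an ordinary differential expression (`jangOp_comp_tau`). With
`n = ∇τ` and `W = 1 + φ²ψ'²` it is `φψ'/√W · H + (φψ'' + 2ψ' ∂ₙφ)/W^(3/2) - Tr k - k(n,n)/W`, where
`H` and `Tr k` belong to the level set of `τ`.

For the profile, `φψ' = -X` with `X = Aφ̃ t^(-(l+1)/2)`, which is large near the boundary; here `A`
is a positive multiple of `α`. The first and third terms together give `-θ₊` up to `O(X⁻²)`. In the
second, the contribution of `b` from `∂ₙφ` combines with `ψ''` to leave `κ/(t X²) = κ t^l / (A²φ̃²)`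
to leading order, where `κ = (l+1)/2 - b > 0`. It has the same order `t^l` as the bound `θ₊ ≤ c
t^l`, so it wins once `A` is small; the remaining errors are `O(t^(l+1))` and are absorbed by small
`t` (`jang_lower_bound`, `exists_isShiftedSubsolution_profile`).

The comparison is the maximum principle (`le_of_isShiftedSubsolution`). Since `δ > 0`, `ψ(τ + δ)`
stays bounded at the boundary while `f` blows up, so a negative value of `f - ψ(τ + δ)` would
produce an interior minimum. There the gradients agree and ellipticity gives `J(ψ) ≤ J(f) = 0`,
contradicting strictness.

The eikonal equation is proved without geodesics: `|∇τ| ≤ 1` because `τ` is 1-Lipschitz for the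
Riemannian distance, and `|∇τ| ≥ 1` because almost shortest curves to the boundary must lower `τ` at
nearly unit rate. -/

namespace Jang

/-! ### Linear algebra: positive semidefinite pairings and Gram matrices. -/

section LinearAlgebra

open Matrix

variable {ι : Type*} [Fintype ι]

/-- Factoring `A = Cᴴ * C` turns the pairing into a sum of values of the form `B` on the rows of
`C`. Symmetry of `B` plays no role. -/
lemma sum_sum_mul_nonneg_of_posSemidef [DecidableEq ι] {A : Matrix ι ι ℝ} (hA : A.PosSemidef)
    {B : ι → ι → ℝ} (hB : ∀ v : ι → ℝ, 0 ≤ ∑ i, ∑ j, v i * v j * B i j) :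
    0 ≤ ∑ i, ∑ j, A i j * B i j := by
  obtain ⟨C, rfl⟩ : ∃ C : Matrix ι ι ℝ, A = Cᴴ * C := by
    open scoped MatrixOrder in
    simpa [Matrix.nonneg_iff_posSemidef, star_eq_conjTranspose] using
      (CStarAlgebra.nonneg_iff_eq_star_mul_self (a := A)).1 hA.nonneg
  have : ∑ i, ∑ j, (Cᴴ * C) i j * B i j = ∑ m, ∑ i, ∑ j, C m i * C m j * B i j := by
    simp only [Matrix.mul_apply, conjTranspose_apply, star_trivial, Finset.sum_mul]
    rw [Finset.sum_comm' (t' := Finset.univ) (s' := fun _ ↦ Finset.univ) (by simp)]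
    rw [Finset.sum_comm]
    conv_lhs => enter [2, i]; rw [Finset.sum_comm]
    rw [Finset.sum_comm]
  rw [this]
  exact Finset.sum_nonneg fun m _ ↦ hB _

lemma dotProduct_mulVec_eq_sum (P : Matrix ι ι ℝ) (v w : ι → ℝ) :
    v ⬝ᵥ (P *ᵥ w) = ∑ i, ∑ j, v i * w j * P i j := by
  simp only [dotProduct, mulVec, Finset.mul_sum]
  exact Finset.sum_congr rfl fun i _ ↦ Finset.sum_congr rfl fun j _ ↦ by ring

/-- Evaluate the form of `P` at `v - (a s) p`, where `s = pᵀPv`; the bound on `a` absorbs the term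
quadratic in `a`. This gives both ellipticity of the Jang operator and, for `a = 1`,
semidefiniteness of the level set metric. -/
lemma posSemidef_sub_smul_vecMulVec {P : Matrix ι ι ℝ} (hP : P.PosSemidef) (p : ι → ℝ) {a : ℝ}
    (ha : 0 ≤ a) (h : a * (p ⬝ᵥ (P *ᵥ p)) ≤ 1) :
    (P - a • vecMulVec (P *ᵥ p) (P *ᵥ p)).PosSemidef := by
  have hsymm : Pᵀ = P := 
    (conjTranspose_eq_transpose_of_trivial P).symm.trans hP.isHermitian
  refine .of_dotProduct_mulVec_nonneg ?_ fun v ↦ ?_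
  · ext i j
    have := congr_fun (congr_fun hsymm i) j
    simp only [transpose_apply] at this
    simp [vecMulVec_apply, this, mul_comm]
  · set s := (P *ᵥ p) ⬝ᵥ v with hs
    have h1 := hP.dotProduct_mulVec_nonneg (v - (a * s) • p)
    have h2 : p ⬝ᵥ (P *ᵥ v) = s := by
      rw [dotProduct_mulVec, ← mulVec_transpose, hsymm]
    have h3 : v ⬝ᵥ (P *ᵥ p) = s := dotProduct_comm _ _
    have h4 : v ⬝ᵥ ((a • vecMulVec (P *ᵥ p) (P *ᵥ p)) *ᵥ v) = a * s ^ 2 := by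
      rw [smul_mulVec, dotProduct_smul, vecMulVec_mulVec, ← hs]
      simp [h3, sq]
    simp only [star_trivial, mulVec_sub, mulVec_smul, dotProduct_sub, sub_dotProduct,
      smul_dotProduct, dotProduct_smul, h2, h3, smul_eq_mul] at h1
    rw [star_trivial, sub_mulVec, dotProduct_sub, h4]
    nlinarith [mul_nonneg ha (sq_nonneg s)]

/-- The coefficients `l` of a linear functional in a basis `e` and the Gram matrix of `e` give the
vector representing the functional. -/
lemma inner_sum_gram_inv {V : Type*} [NormedAddCommGroup V] [InnerProductSpace ℝ V] [DecidableEq ι]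
    (e : ι → V) (G : Matrix ι ι ℝ) (hG : ∀ i j, G i j = inner ℝ (e i) (e j)) (hdet : IsUnit G.det)
    (l c : ι → ℝ) :
    inner ℝ (∑ i, (G⁻¹ *ᵥ l) i • e i) (∑ i, c i • e i) = ∑ i, c i * l i := by
  have hsymm : Gᵀ = G := by ext i j; rw [transpose_apply, hG, hG, real_inner_comm]
  have h1 : inner ℝ (∑ i, (G⁻¹ *ᵥ l) i • e i) (∑ i, c i • e i)
      = (G⁻¹ *ᵥ l) ⬝ᵥ (G *ᵥ c) := by
    rw [dotProduct_mulVec_eq_sum, sum_inner]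
    simp only [inner_sum, inner_smul_left, inner_smul_right, hG]
    exact Finset.sum_congr rfl fun i _ ↦ Finset.sum_congr rfl fun j _ ↦ by simp; ring
  rw [h1, dotProduct_mulVec, ← mulVec_transpose, hsymm, mulVec_mulVec,
    Matrix.mul_nonsing_inv G hdet, one_mulVec, dotProduct_comm]
  rfl

end LinearAlgebra

/-! ### Algebra of the Jang operator on functions of the distance. -/

section Contraction

variable {P B K : Fin 3 → Fin 3 → ℝ} {n : Fin 3 → ℝ}

lemma sum_sum_sub_mul_div_sub (P B K : Fin 3 → Fin 3 → ℝ) (n : Fin 3 → ℝ) (a s : ℝ) :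
    ∑ i, ∑ j, (P i j - a * (n i * n j)) * (B i j / s - K i j)
      = (∑ i, ∑ j, P i j * B i j) / s - ∑ i, ∑ j, P i j * K i j
        - a * ((∑ i, ∑ j, n i * n j * B i j) / s - ∑ i, ∑ j, n i * n j * K i j) := by
  simp only [Finset.sum_div, Finset.mul_sum, ← Finset.sum_sub_distrib]
  exact Finset.sum_congr rfl fun i _ ↦ Finset.sum_congr rfl fun j _ ↦ by ring

/-- The Jang operator evaluated on a function of `τ`, as an algebraic identity: `p` are the
components of `dτ`, `n` those of `∇τ`, `S` those of the Hessian of `τ`. -/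
lemma jang_contraction (P S K : Fin 3 → Fin 3 → ℝ) (n p r : Fin 3 → ℝ) (F y z : ℝ)
    (hsymm : ∀ i j, P i j = P j i)
    (hn : ∀ i, n i = ∑ j, P i j * p j) (hnp : ∑ i, n i * p i = 1)
    (hS : ∑ i, ∑ j, n i * n j * S i j = 0) :
    ∑ i, ∑ j, (P i j - F ^ 2 * (y * n i) * (y * n j) / (1 + F ^ 2 * y ^ 2))
      * ((F * (y * S i j + z * (p i * p j)) + r i * (y * p j) + r j * (y * p i))
        / √(1 + F ^ 2 * y ^ 2) - K i j)
    = F * y / √(1 + F ^ 2 * y ^ 2) * (∑ i, ∑ j, (P i j - n i * n j) * S i j)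
      + (F * z + 2 * y * ∑ i, n i * r i) / ((1 + F ^ 2 * y ^ 2) * √(1 + F ^ 2 * y ^ 2))
      - (∑ i, ∑ j, (P i j - n i * n j) * K i j)
      - (∑ i, ∑ j, n i * n j * K i j) / (1 + F ^ 2 * y ^ 2) := by
  have hW : 0 < 1 + F ^ 2 * y ^ 2 := by positivity
  set W := 1 + F ^ 2 * y ^ 2 with hWdef
  -- Since `F²y²/W = 1 - 1/W`, tangential directions keep full weight and the normal direction gets
  -- weight `1/W`.
  have e1 : ∀ i j, P i j - F ^ 2 * (y * n i) * (y * n j) / W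
      = P i j - (1 - 1 / W) * (n i * n j) := by
    intro i j
    have : 1 - 1 / W = F ^ 2 * y ^ 2 / W := by rw [hWdef]; field_simp; ring
    rw [this]; ring
  simp only [e1]
  rw [sum_sum_sub_mul_div_sub]
  set B : Fin 3 → Fin 3 → ℝ :=
    fun i j ↦ F * (y * S i j + z * (p i * p j)) + r i * (y * p j) + r j * (y * p i) with hB
  have hPpp : ∑ i, ∑ j, P i j * (p i * p j) = 1 := by
    rw [← hnp]
    simp only [hn, Finset.sum_mul]
    exact Finset.sum_congr rfl fun i _ ↦ Finset.sum_congr rfl fun j _ ↦ by ring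
  have hPrp : ∑ i, ∑ j, P i j * (r i * p j) = ∑ i, n i * r i := by
    simp only [hn, Finset.sum_mul]
    exact Finset.sum_congr rfl fun i _ ↦ Finset.sum_congr rfl fun j _ ↦ by ring
  have hPpr : ∑ i, ∑ j, P i j * (r j * p i) = ∑ i, n i * r i := by
    rw [← hPrp, Finset.sum_comm]
    exact Finset.sum_congr rfl fun i _ ↦ Finset.sum_congr rfl fun j _ ↦ by rw [hsymm j i]
  have hnpp : ∑ i, ∑ j, n i * n j * (p i * p j) = 1 := by
    have : ∑ i, ∑ j, n i * n j * (p i * p j) = (∑ i, n i * p i) * ∑ j, n j * p j := by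
      rw [Finset.sum_mul_sum]
      exact Finset.sum_congr rfl fun i _ ↦ Finset.sum_congr rfl fun j _ ↦ by ring
    rw [this, hnp, one_mul]
  have hnrp : ∑ i, ∑ j, n i * n j * (r i * p j) = ∑ i, n i * r i := by
    have : ∑ i, ∑ j, n i * n j * (r i * p j) = (∑ i, n i * r i) * ∑ j, n j * p j := by
      rw [Finset.sum_mul_sum]
      exact Finset.sum_congr rfl fun i _ ↦ Finset.sum_congr rfl fun j _ ↦ by ring
    rw [this, hnp, mul_one]
  have hnpr : ∑ i, ∑ j, n i * n j * (r j * p i) = ∑ i, n i * r i := by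
    rw [← hnrp, Finset.sum_comm]
    exact Finset.sum_congr rfl fun i _ ↦ Finset.sum_congr rfl fun j _ ↦ by ring
  have split : ∀ Q : Fin 3 → Fin 3 → ℝ, ∑ i, ∑ j, Q i j * B i j
      = F * y * (∑ i, ∑ j, Q i j * S i j) + F * z * (∑ i, ∑ j, Q i j * (p i * p j))
        + y * (∑ i, ∑ j, Q i j * (r i * p j)) + y * (∑ i, ∑ j, Q i j * (r j * p i)) := by
    intro Q
    simp only [hB, Finset.mul_sum, ← Finset.sum_add_distrib]
    exact Finset.sum_congr rfl fun i _ ↦ Finset.sum_congr rfl fun j _ ↦ by ring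
  have sub : ∀ X : Fin 3 → Fin 3 → ℝ, ∑ i, ∑ j, (P i j - n i * n j) * X i j
      = (∑ i, ∑ j, P i j * X i j) - ∑ i, ∑ j, n i * n j * X i j := by
    intro X
    simp only [← Finset.sum_sub_distrib, sub_mul]
  rw [split, split (fun i j ↦ n i * n j), sub, sub, hPpp, hPrp, hPpr, hnpp, hnrp, hnpr, hS]
  have hs : 0 < √W := Real.sqrt_pos.2 hW
  field_simp
  ring

end Contraction


/-! ### Coordinate derivatives at interior points and the second derivative test. -/

section Calculus

/-- A negative second derivative would make the point a local maximum as well, so `g` would be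
locally constant and its second derivative zero. -/
lemma deriv_deriv_nonneg_of_isLocalMin {g : ℝ → ℝ} {x : ℝ} (h : IsLocalMin g x)
    (hc : ContinuousAt g x) : 0 ≤ deriv (deriv g) x := by
  by_contra! hlt
  have hmax := isLocalMax_of_deriv_deriv_neg hlt h.deriv_eq_zero hc
  have hconst : g =ᶠ[𝓝 x] fun _ ↦ g x := by
    filter_upwards [h, hmax] with y h1 h2 using le_antisymm h2 h1
  have h1 : deriv g =ᶠ[𝓝 x] fun _ ↦ 0 := by
    simpa using hconst.deriv
  rw [h1.deriv_eq] at hlt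
  simp at hlt

variable {h : E3 → ℝ} {u : E3} {i j : Fin 3}

lemma eventually_range_mem_nhds (hu : Set.range (𝓡∂ 3) ∈ 𝓝 u) :
    ∀ᶠ v in 𝓝 u, Set.range (𝓡∂ 3) ∈ 𝓝 v :=
  eventually_mem_nhds_iff.2 hu

lemma pderiv_eq_fderiv (hu : Set.range (𝓡∂ 3) ∈ 𝓝 u) (i : Fin 3) (h : E3 → ℝ) :
    pderiv i h u = fderiv ℝ h u (basisVec i) := by
  rw [pderiv, fderivWithin_of_mem_nhds hu]

lemma pderiv_eventuallyEq_fderiv (hu : Set.range (𝓡∂ 3) ∈ 𝓝 u) (i : Fin 3) (h : E3 → ℝ) :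
    (fun v ↦ pderiv i h v) =ᶠ[𝓝 u] fun v ↦ fderiv ℝ h v (basisVec i) :=
  (eventually_range_mem_nhds hu).mono fun _ hv ↦ pderiv_eq_fderiv hv i h

lemma pderiv_congr (hu : Set.range (𝓡∂ 3) ∈ 𝓝 u) {h' : E3 → ℝ} (hh : h =ᶠ[𝓝 u] h') :
    pderiv i h u = pderiv i h' u := by
  rw [pderiv_eq_fderiv hu, pderiv_eq_fderiv hu, hh.fderiv_eq]

lemma pderiv_mul (hu : Set.range (𝓡∂ 3) ∈ 𝓝 u) {h' : E3 → ℝ} (hh : DifferentiableAt ℝ h u)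
    (hh' : DifferentiableAt ℝ h' u) (i : Fin 3) :
    pderiv i (fun v ↦ h v * h' v) u = h u * pderiv i h' u + h' u * pderiv i h u := by
  simp only [pderiv_eq_fderiv hu, fderiv_fun_mul hh hh']
  simp

lemma pderiv_sum (hu : Set.range (𝓡∂ 3) ∈ 𝓝 u) {ι : Type*} {s : Finset ι} {h : ι → E3 → ℝ}
    (hh : ∀ a ∈ s, DifferentiableAt ℝ (h a) u) (i : Fin 3) :
    pderiv i (fun v ↦ ∑ a ∈ s, h a v) u = ∑ a ∈ s, pderiv i (h a) u := by
  simp only [pderiv_eq_fderiv hu, fderiv_fun_sum hh]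
  simp

lemma pderiv_comp (hu : Set.range (𝓡∂ 3) ∈ 𝓝 u) {ψ : ℝ → ℝ} (hh : DifferentiableAt ℝ h u)
    (hψ : DifferentiableAt ℝ ψ (h u)) (i : Fin 3) :
    pderiv i (fun v ↦ ψ (h v)) u = deriv ψ (h u) * pderiv i h u := by
  have := (hψ.hasDerivAt.comp_hasFDerivAt u hh.hasFDerivAt).fderiv
  rw [Function.comp_def] at this
  rw [pderiv_eq_fderiv hu, pderiv_eq_fderiv hu, this]
  simp

lemma contDiffAt_pderiv (hu : Set.range (𝓡∂ 3) ∈ 𝓝 u) {m n : WithTop ℕ∞}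
    (hh : ContDiffAt ℝ n h u) (hmn : m + 1 ≤ n) (i : Fin 3) :
    ContDiffAt ℝ m (fun v ↦ pderiv i h v) u := by
  refine ContDiffAt.congr_of_eventuallyEq ?_ (pderiv_eventuallyEq_fderiv hu i h)
  exact (hh.fderiv_right hmn).clm_apply contDiffAt_const

lemma pderiv_pderiv_comp (hu : Set.range (𝓡∂ 3) ∈ 𝓝 u) {ψ : ℝ → ℝ} (hh : ContDiffAt ℝ 2 h u)
    (hψ : ContDiffAt ℝ 2 ψ (h u)) (i j : Fin 3) :
    pderiv i (fun v ↦ pderiv j (fun w ↦ ψ (h w)) v) u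
      = deriv ψ (h u) * pderiv i (fun v ↦ pderiv j h v) u
        + deriv (deriv ψ) (h u) * (pderiv i h u * pderiv j h u) := by
  have e : (fun v ↦ pderiv j (fun w ↦ ψ (h w)) v)
      =ᶠ[𝓝 u] fun v ↦ deriv ψ (h v) * pderiv j h v := by
    filter_upwards [eventually_range_mem_nhds hu, hh.eventually (by simp),
      hh.continuousAt.eventually (hψ.eventually (by simp))] with v h1 h2 h3
    exact pderiv_comp h1 (h2.differentiableAt (by simp)) (h3.differentiableAt (by simp)) j
  have hψ' : DifferentiableAt ℝ (deriv ψ) (h u) :=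
    ((hψ.fderiv_right (m := 1) (by norm_num)).clm_apply contDiffAt_const).differentiableAt
      (by simp)
  rw [pderiv_congr hu e, pderiv_mul hu, pderiv_comp hu (hh.differentiableAt (by simp)) hψ']
  · ring
  · exact hψ'.comp u (hh.differentiableAt (by simp))
  · exact (contDiffAt_pderiv hu hh (m := 1) (by norm_num) j).differentiableAt (by simp)

lemma pderiv_eq_zero_of_isLocalMin (hu : Set.range (𝓡∂ 3) ∈ 𝓝 u) (hmin : IsLocalMin h u) :
    pderiv i h u = 0 := by
  rw [pderiv_eq_fderiv hu, hmin.fderiv_eq_zero]; simp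

lemma sum_smul_basisVec (v : Fin 3 → ℝ) : ∑ i, v i • basisVec i = WithLp.toLp 2 v := by
  ext j
  simp [basisVec, Finset.sum_apply, Pi.single_apply]

/-- This is the one-variable test on the line `s ↦ u + s • V`. -/
lemma sum_pderiv_pderiv_nonneg_of_isLocalMin (hu : Set.range (𝓡∂ 3) ∈ 𝓝 u)
    (hh : ContDiffAt ℝ 2 h u) (hmin : IsLocalMin h u) (v : Fin 3 → ℝ) :
    0 ≤ ∑ i, ∑ j, v i * v j * pderiv i (fun w ↦ pderiv j h w) u := by
  set V : E3 := ∑ i, v i • basisVec i with hV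
  let γ : ℝ → E3 := fun s ↦ u + s • V
  have hγ0 : γ 0 = u := by simp [γ]
  have hγ : ∀ s, HasDerivAt γ V s := fun s ↦ by
    simpa [γ] using (((hasDerivAt_id s).smul_const V).const_add u)
  have hγc : ContinuousAt γ 0 := (hγ 0).continuousAt
  have hmin' : IsLocalMin (fun s ↦ h (γ s)) 0 := by
    have : ∀ᶠ s in 𝓝 (0 : ℝ), h u ≤ h (γ s) := by
      have := hγc.tendsto; rw [hγ0] at this
      exact this.eventually hmin
    simpa [IsLocalMin, IsMinFilter, hγ0] using this
  have hd : deriv (fun s ↦ h (γ s)) =ᶠ[𝓝 0] fun s ↦ ∑ j, v j * pderiv j h (γ s) := by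
    have h1 : ∀ᶠ w in 𝓝 (γ 0), ContDiffAt ℝ 2 h w := by rw [hγ0]; exact hh.eventually (by simp)
    have h2 : ∀ᶠ w in 𝓝 (γ 0), Set.range (𝓡∂ 3) ∈ 𝓝 w := by
      rw [hγ0]; exact eventually_range_mem_nhds hu
    filter_upwards [hγc.eventually h1, hγc.eventually h2] with s hs1 hs2
    have := ((hs1.differentiableAt (by simp)).hasFDerivAt.comp_hasDerivAt s (hγ s)).deriv
    rw [Function.comp_def] at this
    rw [this, hV]
    simp [pderiv_eq_fderiv hs2]
  have hdd : deriv (deriv (fun s ↦ h (γ s))) 0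
      = ∑ i, ∑ j, v i * v j * pderiv i (fun w ↦ pderiv j h w) u := by
    rw [hd.deriv_eq]
    have hdiff : ∀ j, DifferentiableAt ℝ (fun w ↦ pderiv j h w) u := fun j ↦
      (contDiffAt_pderiv hu hh (m := 1) (by norm_num) j).differentiableAt (by simp)
    have h1 : ∀ j, HasDerivAt (fun s ↦ pderiv j h (γ s))
        (∑ i, v i * pderiv i (fun w ↦ pderiv j h w) u) 0 := by
      intro j
      have hf : HasFDerivAt (fun w ↦ pderiv j h w) (fderiv ℝ (fun w ↦ pderiv j h w) u) (γ 0) := by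
        rw [hγ0]; exact (hdiff j).hasFDerivAt
      have := hf.comp_hasDerivAt 0 (hγ 0)
      have e : fderiv ℝ (fun w ↦ pderiv j h w) u V
          = ∑ i, v i * pderiv i (fun w ↦ pderiv j h w) u := by
        rw [hV]
        simp [pderiv_eq_fderiv hu]
      rwa [e] at this
    have h2 := HasDerivAt.fun_sum (u := Finset.univ) fun j _ ↦ (h1 j).const_mul (v j)
    rw [h2.deriv, Finset.sum_comm]
    simp only [Finset.mul_sum]
    exact Finset.sum_congr rfl fun i _ ↦ Finset.sum_congr rfl fun j _ ↦ by ring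
  rw [← hdd]
  refine deriv_deriv_nonneg_of_isLocalMin hmin' ?_
  have : ContinuousAt h (γ 0) := by rw [hγ0]; exact hh.continuousAt
  exact this.comp hγc

end Calculus



/-! ### Charts, coordinate vector fields and smoothness of the metric coefficients. -/

section Manifold

variable {M : Type*} [MetricSpace M] [ChartedSpace (EuclideanHalfSpace 3) M]

lemma continuous_tau : Continuous (tau : M → ℝ) := Metric.continuous_infDist_pt _

lemma tau_nonneg (x : M) : 0 ≤ tau x := Metric.infDist_nonneg

lemma lipschitzWith_tau : LipschitzWith 1 (tau : M → ℝ) := Metric.lipschitz_infDist_pt _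

lemma contMDiffAt_tau {T : ℝ} (hT : IsCollarWidth M T) {y : M} (hy : tau y < T) :
    ContMDiffAt (𝓡∂ 3) 𝓘(ℝ, ℝ) ∞ (tau : M → ℝ) y :=
  hT.smooth.contMDiffAt ((isOpen_lt continuous_tau continuous_const).mem_nhds hy)

lemma mem_interior_of_tau_pos {x : M} (hx : 0 < tau x) : x ∈ (𝓡∂ 3).interior M := by
  rw [← ModelWithCorners.compl_boundary]
  intro h
  rw [tau, Metric.infDist_zero_of_mem h] at hx
  exact lt_irrefl _ hx

lemma interior_mem_nhds_of_tau_pos {x : M} (hx : 0 < tau x) : (𝓡∂ 3).interior M ∈ 𝓝 x :=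
  Filter.mem_of_superset ((isOpen_lt continuous_const continuous_tau).mem_nhds hx)
    fun _ hy ↦ mem_interior_of_tau_pos hy

lemma extChartAt_symm_basePt (x : M) : (extChartAt (𝓡∂ 3) x).symm (basePt x) = x :=
  extChartAt_to_inv x

@[simp] lemma inChart_basePt (x : M) (f : M → ℝ) : inChart x f (basePt x) = f x := by
  rw [inChart, extChartAt_symm_basePt]

lemma range_mem_nhds_basePt {x : M} (hx : x ∈ (𝓡∂ 3).interior M) :
    Set.range (𝓡∂ 3) ∈ 𝓝 (basePt x) :=
  range_mem_nhds_isInteriorPoint hx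

lemma target_mem_nhds_basePt {x : M} (hx : x ∈ (𝓡∂ 3).interior M) :
    (extChartAt (𝓡∂ 3) x).target ∈ 𝓝 (basePt x) := by
  have := extChartAt_target_mem_nhdsWithin (I := 𝓡∂ 3) x
  change _ ∈ 𝓝[_] (basePt x) at this
  rwa [nhdsWithin_eq_nhds.2 (range_mem_nhds_basePt hx)] at this

lemma basePt_mem_interior_target {x : M} (hx : x ∈ (𝓡∂ 3).interior M) :
    basePt x ∈ interior (extChartAt (𝓡∂ 3) x).target :=
  mem_interior_iff_mem_nhds.2 (target_mem_nhds_basePt hx)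

lemma range_mem_nhds_of_mem_interior_target {x : M} {u : E3}
    (hu : u ∈ interior (extChartAt (𝓡∂ 3) x).target) : Set.range (𝓡∂ 3) ∈ 𝓝 u :=
  Filter.mem_of_superset (mem_interior_iff_mem_nhds.1 hu) (extChartAt_target_subset_range x)

lemma tendsto_extChartAt_symm_basePt (x : M) :
    Filter.Tendsto (extChartAt (𝓡∂ 3) x).symm (𝓝 (basePt x)) (𝓝 x) := by
  have := continuousAt_extChartAt_symm (I := 𝓡∂ 3) x
  rw [ContinuousAt, extChartAt_to_inv] at this
  exact this

lemma inChart_eventuallyEq {x : M} {f f' : M → ℝ} (h : f =ᶠ[𝓝 x] f') : inChart x f =ᶠ[𝓝 (basePt x)] inChart x f' :=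
  (tendsto_extChartAt_symm_basePt x).eventually h

lemma contDiffAt_inChart {x : M} (hx : x ∈ (𝓡∂ 3).interior M) {n : WithTop ℕ∞} {f : M → ℝ}
    (hf : ContMDiffAt (𝓡∂ 3) 𝓘(ℝ, ℝ) n f x) : ContDiffAt ℝ n (inChart x f) (basePt x) := by
  have := (contMDiffAt_iff.1 hf).2
  exact this.contDiffAt (range_mem_nhds_basePt hx)

lemma mfderivWithin_symm_sum {x : M} {u : E3} (c : Fin 3 → ℝ) :
    mfderivWithin 𝓘(ℝ, E3) (𝓡∂ 3) (extChartAt (𝓡∂ 3) x).symm (Set.range (𝓡∂ 3)) u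
      (∑ i, c i • basisVec i : E3) = ∑ i, c i • coordVec x u i := by
  simp only [coordVec]
  exact (map_sum _ _ _).trans (Finset.sum_congr rfl fun i _ ↦ map_smul _ _ _)

variable [IsManifold (𝓡∂ 3) ∞ M]

variable (M) in
lemma isClosed_boundary : IsClosed ((𝓡∂ 3).boundary M) :=
  (𝓡∂ 3).isClosed_boundary (n := ∞) (by simp)

lemma contMDiffOn_extChartAt_symm_interior (x : M) :
    ContMDiffOn 𝓘(ℝ, E3) (𝓡∂ 3) ∞ (extChartAt (𝓡∂ 3) x).symm
      (interior (extChartAt (𝓡∂ 3) x).target) :=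
  (contMDiffOn_extChartAt_symm x).mono interior_subset

lemma contDiffAt_inChart_of_mem {x : M} {u : E3}
    (hu : u ∈ interior (extChartAt (𝓡∂ 3) x).target) {f : M → ℝ}
    (hf : ContMDiffAt (𝓡∂ 3) 𝓘(ℝ, ℝ) ∞ f ((extChartAt (𝓡∂ 3) x).symm u)) :
    ContDiffAt ℝ ∞ (inChart x f) u :=
  (hf.comp u ((contMDiffOn_extChartAt_symm_interior x).contMDiffAt
    (isOpen_interior.mem_nhds hu))).contDiffAt

/-- The differential of a function on `M`. -/
noncomputable def differential (f : M → ℝ) (y : M) : TangentSpace (𝓡∂ 3) y →L[ℝ] ℝ :=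
  mfderiv (𝓡∂ 3) 𝓘(ℝ, ℝ) f y

lemma pderiv_inChart {x : M} {u : E3} (hu : u ∈ (extChartAt (𝓡∂ 3) x).target) {f : M → ℝ}
    (hf : MDifferentiableAt (𝓡∂ 3) 𝓘(ℝ, ℝ) f ((extChartAt (𝓡∂ 3) x).symm u)) (i : Fin 3) :
    pderiv i (inChart x f) u
      = differential f ((extChartAt (𝓡∂ 3) x).symm u) (coordVec x u i) := by
  have h := mfderiv_comp_mfderivWithin u hf (mdifferentiableWithinAt_extChartAt_symm hu)
    ((𝓡∂ 3).uniqueMDiffOn _ (extChartAt_target_subset_range x hu))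
  rw [mfderivWithin_eq_fderivWithin] at h
  exact congr($h (basisVec i))

/-- Every tangent vector is a combination of the coordinate vectors. -/
lemma exists_sum_coordVec {x : M} {u : E3} (hu : u ∈ (extChartAt (𝓡∂ 3) x).target)
    (v : TangentSpace (𝓡∂ 3) ((extChartAt (𝓡∂ 3) x).symm u)) :
    ∃ c : Fin 3 → ℝ, v = ∑ i, c i • coordVec x u i := by
  obtain ⟨w, hw⟩ := (isInvertible_mfderivWithin_extChartAt_symm hu).bijective.2 v
  refine ⟨fun i ↦ (show E3 from w) i, ?_⟩
  have : w = (∑ i, (show E3 from w) i • basisVec i : E3) := by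
    rw [sum_smul_basisVec]; rfl
  rw [← hw]
  conv_lhs => rw [this]
  simp only [coordVec]
  exact (map_sum _ _ _).trans (Finset.sum_congr rfl fun i _ ↦ map_smul _ _ _)

lemma linearIndependent_coordVec {x : M} {u : E3} (hu : u ∈ (extChartAt (𝓡∂ 3) x).target) :
    LinearIndependent ℝ (coordVec x u) := by
  rw [Fintype.linearIndependent_iff]
  intro c hc i
  rw [← mfderivWithin_symm_sum] at hc
  have h := (isInvertible_mfderivWithin_extChartAt_symm hu).injective
    (hc.trans (map_zero _).symm)
  rw [sum_smul_basisVec] at h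
  exact congr_arg (fun w : E3 ↦ w i) h

variable [Bundle.RiemannianBundle (fun x : M ↦ TangentSpace (𝓡∂ 3) x)]

lemma posDef_metricMat {x : M} {u : E3} (hu : u ∈ (extChartAt (𝓡∂ 3) x).target) :
    (metricMat x u).PosDef :=
  Matrix.posDef_gram_of_linearIndependent (𝕜 := ℝ) (linearIndependent_coordVec hu)

lemma metricMat_symm (x : M) (u : E3) (i j : Fin 3) : metricMat x u i j = metricMat x u j i := by
  simp only [metricMat, Matrix.of_apply]
  exact real_inner_comm _ _

lemma inv_metricMat_symm (x : M) (u : E3) (i j : Fin 3) :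
    (metricMat x u)⁻¹ i j = (metricMat x u)⁻¹ j i := by
  have h : (metricMat x u).transpose = metricMat x u := by ext i j; exact metricMat_symm x u j i
  conv_lhs => rw [← h, ← Matrix.transpose_nonsing_inv]
  rfl

lemma posDef_invMetric (x : M) : (invMetric x).PosDef :=
  (posDef_metricMat (mem_extChartAt_target x)).inv

variable [IsContMDiffRiemannianBundle (𝓡∂ 3) ∞ E3 (fun x : M ↦ TangentSpace (𝓡∂ 3) x)]

/-- The coordinate fields are images of constant fields under the tangent map of the inverse chart,
hence smooth sections, and the metric is smooth on such sections. -/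
lemma contDiffAt_metricMat {x : M} {u : E3} (hu : u ∈ interior (extChartAt (𝓡∂ 3) x).target)
    (i j : Fin 3) : ContDiffAt ℝ ∞ (fun v ↦ metricMat x v i j) u := by
  set s := interior (extChartAt (𝓡∂ 3) x).target with hs
  have hso : IsOpen s := isOpen_interior
  have key : ∀ i, ContMDiffAt 𝓘(ℝ, E3) (𝓡∂ 3).tangent ∞
      (fun v ↦ (⟨(extChartAt (𝓡∂ 3) x).symm v, coordVec x v i⟩ : TangentBundle (𝓡∂ 3) M)) u := by
    intro i
    have h1 : ContMDiffOn 𝓘(ℝ, E3).tangent (𝓡∂ 3).tangent ∞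
        (tangentMapWithin 𝓘(ℝ, E3) (𝓡∂ 3) (extChartAt (𝓡∂ 3) x).symm s) _ :=
      (contMDiffOn_extChartAt_symm_interior x).contMDiffOn_tangentMapWithin (m := ∞) (by simp)
        hso.uniqueMDiffOn
    have h2 : ContMDiff 𝓘(ℝ, E3) 𝓘(ℝ, E3).tangent ∞
        (fun v ↦ (⟨v, basisVec i⟩ : TangentBundle 𝓘(ℝ, E3) E3)) :=
      contMDiff_vectorSpace_iff_contDiff.2 contDiff_const
    have h3 := (h1.comp h2.contMDiffOn (s := s) (fun v hv ↦ hv)).contMDiffAt (hso.mem_nhds hu)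
    refine h3.congr_of_eventuallyEq ?_
    filter_upwards [hso.mem_nhds hu] with v hv
    simp only [Function.comp_apply, tangentMapWithin, coordVec]
    -- The two sides differentiate within different sets; both are neighbourhoods of `v`.
    rw [mfderivWithin_of_mem_nhds (hso.mem_nhds hv),
      mfderivWithin_of_mem_nhds (range_mem_nhds_of_mem_interior_target hv)]
  exact (ContMDiffAt.inner_bundle (key i) (key j)).contDiffAt

end Manifold



/-! ### Bounds on the differential of the distance from lengths of curves. -/

section Eikonal

open MeasureTheory Set

variable {M : Type*} [MetricSpace M] [ChartedSpace (EuclideanHalfSpace 3) M]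
  [Bundle.RiemannianBundle (fun x : M ↦ TangentSpace (𝓡∂ 3) x)]

/-- The squared norm `|∇f|²` as a function of the coordinates of the preferred chart at `x`. -/
noncomputable def chartGradSq (x : M) (f : M → ℝ) (u : E3) : ℝ :=
  ∑ i, ∑ j, (metricMat x u)⁻¹ i j * pderiv j (inChart x f) u * pderiv i (inChart x f) u

lemma gradNormSq_eq_chartGradSq (f : M → ℝ) (x : M) :
    gradNormSq f x = chartGradSq x f (basePt x) := by
  simp only [gradNormSq, gradAt, chartGradSq, Finset.sum_mul]
  rfl

lemma norm_sq_sum_coordVec (x : M) (u : E3) (c : Fin 3 → ℝ) :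
    ‖∑ i, c i • coordVec x u i‖ ^ 2 = ∑ i, ∑ j, c i * c j * metricMat x u i j := by
  rw [← real_inner_self_eq_norm_sq, sum_inner]
  simp only [inner_sum, inner_smul_left, inner_smul_right, metricMat, Matrix.of_apply]
  exact Finset.sum_congr rfl fun i _ ↦ Finset.sum_congr rfl fun j _ ↦ by simp; ring

variable [IsManifold (𝓡∂ 3) ∞ M]

/-- Raising the index with the inverse Gram matrix makes `chartGradSq` an intrinsic norm, so that
coordinate expressions can be compared with lengths of curves. -/
lemma exists_gradient {x : M} {u : E3} (hu : u ∈ (extChartAt (𝓡∂ 3) x).target) {f : M → ℝ}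
    (hf : MDifferentiableAt (𝓡∂ 3) 𝓘(ℝ, ℝ) f ((extChartAt (𝓡∂ 3) x).symm u)) :
    ∃ w : TangentSpace (𝓡∂ 3) ((extChartAt (𝓡∂ 3) x).symm u),
      (w = ∑ i, (∑ j, (metricMat x u)⁻¹ i j * pderiv j (inChart x f) u) • coordVec x u i) ∧
      (∀ v, differential f ((extChartAt (𝓡∂ 3) x).symm u) v = inner ℝ w v) ∧
      ‖w‖ ^ 2 = chartGradSq x f u := by
  set l : Fin 3 → ℝ := fun i ↦ pderiv i (inChart x f) u with hl
  have key := inner_sum_gram_inv (coordVec x u) (metricMat x u) (fun _ _ ↦ rfl)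
    (posDef_metricMat hu).det_pos.ne'.isUnit l
  refine ⟨∑ i, ((metricMat x u)⁻¹.mulVec l) i • coordVec x u i, rfl, fun v ↦ ?_, ?_⟩
  · obtain ⟨c, rfl⟩ := exists_sum_coordVec hu v
    rw [key]
    refine (map_sum _ _ _).trans (Finset.sum_congr rfl fun i _ ↦ (map_smul _ _ _).trans ?_)
    rw [← pderiv_inChart hu hf]
    rfl
  · rw [← real_inner_self_eq_norm_sq, key]
    simp only [chartGradSq, Matrix.mulVec, dotProduct, Finset.sum_mul, hl]

/-- Integrate `|d(f ∘ γ)| ≤ q |γ'|` along the curve. -/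
lemma enorm_sub_le_pathELength {f : M → ℝ} {γ : ℝ → M} {a b q : ℝ} (hq : 0 ≤ q) (hab : a ≤ b)
    (hγ : ContMDiffOn 𝓘(ℝ, ℝ) (𝓡∂ 3) 1 γ (Icc a b))
    (hf : ∀ s ∈ Icc a b, ContMDiffAt (𝓡∂ 3) 𝓘(ℝ, ℝ) 1 f (γ s))
    (hle : ∀ s ∈ Icc a b, ∀ v : TangentSpace (𝓡∂ 3) (γ s),
      |differential f (γ s) v| ≤ q * ‖v‖) :
    ‖f (γ b) - f (γ a)‖ₑ ≤ ENNReal.ofReal q * Manifold.pathELength (𝓡∂ 3) γ a b := by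
  have hc : ContDiffOn ℝ 1 (f ∘ γ) (Icc a b) :=
    contMDiffOn_iff_contDiffOn.1 fun s hs ↦ (hf s hs).comp_contMDiffWithinAt s (hγ s hs)
  refine (enorm_sub_le_lintegral_deriv_of_contDiffOn_Icc hc hab).trans ?_
  rw [Manifold.pathELength_eq_lintegral_mfderiv_Icc, ← lintegral_const_mul' _ _ ENNReal.ofReal_ne_top,
    ← restrict_Ioo_eq_restrict_Icc]
  refine setLIntegral_mono' measurableSet_Ioo fun s hs ↦ ?_
  have hs' := Ioo_subset_Icc_self hs
  have hγs : MDifferentiableAt 𝓘(ℝ, ℝ) (𝓡∂ 3) γ s :=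
    ((hγ s hs').contMDiffAt (Icc_mem_nhds hs.1 hs.2)).mdifferentiableAt one_ne_zero
  have h1 : deriv (f ∘ γ) s
      = differential f (γ s) (mfderiv 𝓘(ℝ, ℝ) (𝓡∂ 3) γ s 1) := by
    have := mfderiv_comp (I' := 𝓡∂ 3) s ((hf s hs').mdifferentiableAt one_ne_zero) hγs
    rw [mfderiv_eq_fderiv] at this
    rw [← fderiv_apply_one_eq_deriv]
    exact congr($this 1)
  rw [h1, ← ofReal_norm, ← ofReal_norm, ← ENNReal.ofReal_mul hq]
  exact ENNReal.ofReal_le_ofReal (hle s hs' _)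

variable [IsRiemannianManifold (𝓡∂ 3) M]

lemma edist_le_pathELength {γ : ℝ → M} {a b : ℝ} (hab : a ≤ b)
    (hγ : ContMDiffOn 𝓘(ℝ, ℝ) (𝓡∂ 3) 1 γ (Icc a b)) :
    edist (γ a) (γ b) ≤ Manifold.pathELength (𝓡∂ 3) γ a b := by
  rw [IsRiemannianManifold.out (I := 𝓡∂ 3)]
  exact Manifold.riemannianEDist_le_pathELength hγ rfl rfl hab

/-- Along near-minimizing curves to the boundary, `τ` decreases at unit speed. -/
lemma not_eventually_abs_differential_tau_le {y : M} (hy : 0 < tau y) {q : ℝ} (hq0 : 0 ≤ q)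
    (hq1 : q < 1)
    (hd : ∀ᶠ z in 𝓝 y, ContMDiffAt (𝓡∂ 3) 𝓘(ℝ, ℝ) 1 (tau : M → ℝ) z ∧
      ∀ v : TangentSpace (𝓡∂ 3) z, |differential tau z v| ≤ q * ‖v‖) :
    False := by
  obtain ⟨r, hr, hball⟩ := Metric.eventually_nhds_iff.1 hd
  -- Radius inside the region where the bound `q` holds, and below `τ(y)`, so every curve to the
  -- boundary leaves the ball.
  set ρ := min (r / 2) (tau y / 2) with hρdef
  have hρ : 0 < ρ := by positivity
  have hρr : ρ < r := (min_le_left _ _).trans_lt (by linarith)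
  have hρt : ρ < tau y := (min_le_right _ _).trans_lt (by linarith)
  have hne : ((𝓡∂ 3).boundary M).Nonempty := by
    by_contra h
    rw [Set.not_nonempty_iff_eq_empty] at h
    simp [tau, h] at hy
  -- The slack `(1 - q)ρ` is what the curve loses in the ball: its part there has length `L₁ ≥ ρ`
  -- but lowers `τ` by at most `q L₁`.
  obtain ⟨p, hp, hyp⟩ := (Metric.infDist_lt_iff hne).1
    (show Metric.infDist y ((𝓡∂ 3).boundary M) < tau y + (1 - q) * ρ by
      rw [← tau]; nlinarith)
  have hyp' : Manifold.riemannianEDist (𝓡∂ 3) y p < ENNReal.ofReal (tau y + (1 - q) * ρ) := by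
    rw [← IsRiemannianManifold.out (I := 𝓡∂ 3), edist_dist]
    exact (ENNReal.ofReal_lt_ofReal_iff (by nlinarith)).2 hyp
  obtain ⟨γ, h0, h1, hγ, hL⟩ := Manifold.exists_lt_of_riemannianEDist_lt hyp'
  have hcont : ContinuousOn (fun s ↦ dist y (γ s)) (Icc 0 1) :=
    Continuous.comp_continuousOn (by fun_prop) hγ.continuousOn
  have hS : IsCompact (Icc (0 : ℝ) 1 ∩ (fun s ↦ dist y (γ s)) ⁻¹' Ici ρ) :=
    isCompact_Icc.of_isClosed_subset (hcont.preimage_isClosed_of_isClosed isClosed_Icc isClosed_Ici)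
      inter_subset_left
  have hp1 : tau y ≤ dist y (γ 1) := by rw [h1]; exact Metric.infDist_le_dist_of_mem hp
  -- `s₀` is the first time at distance at least `ρ` from `y`.
  obtain ⟨s₀, ⟨hs₀, hs₀ρ⟩, hleast⟩ := hS.exists_isLeast ⟨1, by simp, by
    simpa using hρt.le.trans hp1⟩
  have hlt : ∀ s ∈ Icc 0 s₀, dist y (γ s) ≤ ρ := by
    intro s hs
    by_contra! hgt
    have hc : ContinuousOn (fun s ↦ dist y (γ s)) (Icc 0 s) :=
      hcont.mono (Icc_subset_Icc_right (hs.2.trans hs₀.2))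
    obtain ⟨s', hs', hs'ρ⟩ := intermediate_value_Icc hs.1 hc
      (show ρ ∈ Icc _ _ from ⟨by simp [h0, hρ.le], hgt.le⟩)
    have := hleast ⟨⟨hs'.1, hs'.2.trans (hs.2.trans hs₀.2)⟩, hs'ρ.ge⟩
    have e : s' = s := le_antisymm hs'.2 (hs.2.trans this)
    rw [e] at hs'ρ
    exact hgt.ne' hs'ρ
  have hγ1 := hγ.mono (Icc_subset_Icc_right hs₀.2)
  have hγ2 := hγ.mono (Icc_subset_Icc_left hs₀.1)
  have hmem : ∀ s ∈ Icc 0 s₀, dist (γ s) y < r := fun s hs ↦ by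
    rw [dist_comm]; exact (hlt s hs).trans_lt hρr
  have hA := enorm_sub_le_pathELength (f := tau) hq0 hs₀.1 hγ1 (fun s hs ↦ (hball (hmem s hs)).1)
    (fun s hs ↦ (hball (hmem s hs)).2)
  have hB := edist_le_pathELength hs₀.1 hγ1
  have hC := edist_le_pathELength hs₀.2 hγ2
  rw [← Manifold.pathELength_add hs₀.1 hs₀.2] at hL
  set L₁ := Manifold.pathELength (𝓡∂ 3) γ 0 s₀
  set L₂ := Manifold.pathELength (𝓡∂ 3) γ s₀ 1
  have hL₁ : L₁ ≠ ⊤ := ne_top_of_lt (lt_of_le_of_lt le_self_add hL)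
  have hL₂ : L₂ ≠ ⊤ := ne_top_of_lt (lt_of_le_of_lt le_add_self hL)
  have hL' : L₁.toReal + L₂.toReal < tau y + (1 - q) * ρ := by
    rw [← ENNReal.toReal_add hL₁ hL₂]
    exact (ENNReal.lt_ofReal_iff_toReal_lt (ENNReal.add_ne_top.2 ⟨hL₁, hL₂⟩)).1 hL
  have hA' : |tau (γ s₀) - tau (γ 0)| ≤ q * L₁.toReal := by
    have := ENNReal.toReal_mono (ENNReal.mul_ne_top ENNReal.ofReal_ne_top hL₁) hA
    simpa [ENNReal.toReal_mul, hq0] using this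
  have hB' : dist (γ 0) (γ s₀) ≤ L₁.toReal := by
    rw [dist_edist]; exact ENNReal.toReal_mono hL₁ hB
  have hC' : dist (γ s₀) (γ 1) ≤ L₂.toReal := by
    rw [dist_edist]; exact ENNReal.toReal_mono hL₂ hC
  have hD : tau (γ s₀) ≤ dist (γ s₀) (γ 1) := by rw [h1]; exact Metric.infDist_le_dist_of_mem hp
  have hE : ρ ≤ dist (γ 0) (γ s₀) := by rw [h0]; exact hs₀ρ
  rw [h0] at hA'
  have hF := (abs_le.1 hA').1
  nlinarith

variable [IsContMDiffRiemannianBundle (𝓡∂ 3) ∞ E3 (fun x : M ↦ TangentSpace (𝓡∂ 3) x)]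

/-- A straight coordinate segment in direction `v` has length at most `m |s|` for any `m > ‖v‖` and
small `s`, so the difference quotients of `f` along it are at most `m`. -/
lemma abs_differential_le_of_lipschitz {f : M → ℝ} (hf : LipschitzWith 1 f) {x : M} {u : E3}
    (hu : u ∈ interior (extChartAt (𝓡∂ 3) x).target)
    (hd : ContMDiffAt (𝓡∂ 3) 𝓘(ℝ, ℝ) ∞ f ((extChartAt (𝓡∂ 3) x).symm u))
    (v : TangentSpace (𝓡∂ 3) ((extChartAt (𝓡∂ 3) x).symm u)) :
    |differential f ((extChartAt (𝓡∂ 3) x).symm u) v| ≤ ‖v‖ := by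
  obtain ⟨c, rfl⟩ := exists_sum_coordVec (interior_subset hu) v
  -- The strict margin `m > ‖v‖` lets continuity of the metric bound the speed on a whole
  -- neighbourhood.
  refine le_of_forall_gt_imp_ge_of_dense fun m hm ↦ ?_
  have hm0 : 0 ≤ m := (norm_nonneg _).trans hm.le
  set V : E3 := ∑ i, c i • basisVec i with hV
  let η : ℝ → E3 := fun s ↦ u + s • V
  have hη0 : η 0 = u := by simp [η]
  have hηd : ∀ s, HasDerivAt η V s := fun s ↦ by
    simpa [η] using (((hasDerivAt_id s).smul_const V).const_add u)
  have hηs : ContDiff ℝ ∞ η := by fun_prop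
  have hηc : Filter.Tendsto η (𝓝 0) (𝓝 u) := by
    have := hηs.continuous.tendsto 0; rwa [hη0] at this
  have hnear : ∀ᶠ w in 𝓝 u, w ∈ interior (extChartAt (𝓡∂ 3) x).target ∧
      ‖∑ i, c i • coordVec x w i‖ < m := by
    have hcont : ContinuousAt (fun w ↦ ∑ i, ∑ j, c i * c j * metricMat x w i j) u := by
      refine tendsto_finsetSum _ fun i _ ↦ tendsto_finsetSum _ fun j _ ↦ ?_
      exact (contDiffAt_metricMat hu i j).continuousAt.const_mul _
    have hlt : ∑ i, ∑ j, c i * c j * metricMat x u i j < m ^ 2 := by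
      rw [← norm_sq_sum_coordVec]
      exact pow_lt_pow_left₀ hm (norm_nonneg _) two_ne_zero
    filter_upwards [isOpen_interior.mem_nhds hu, hcont.eventually (gt_mem_nhds hlt)] with w h1 h2
    rw [← norm_sq_sum_coordVec] at h2
    exact ⟨h1, lt_of_pow_lt_pow_left₀ 2 hm0 h2⟩
  obtain ⟨ε, hε, hball⟩ := Metric.eventually_nhds_iff.1 (hηc.eventually hnear)
  simp only [Real.dist_eq, sub_zero] at hball
  let γ : ℝ → M := fun s ↦ (extChartAt (𝓡∂ 3) x).symm (η s)
  have hγd : ∀ s, |s| < ε → ContMDiffAt 𝓘(ℝ, ℝ) (𝓡∂ 3) ∞ γ s := fun s hs ↦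
    ((contMDiffOn_extChartAt_symm_interior x).contMDiffAt
      (isOpen_interior.mem_nhds (hball hs).1)).comp s hηs.contDiffAt.contMDiffAt
  have hγn : ∀ s, |s| < ε → ‖mfderiv 𝓘(ℝ, ℝ) (𝓡∂ 3) γ s 1‖ₑ ≤ ENNReal.ofReal m := by
    intro s hs
    have hmem := (hball hs).1
    have h1 := mfderiv_comp s (((contMDiffOn_extChartAt_symm_interior x).contMDiffAt
      (isOpen_interior.mem_nhds hmem)).mdifferentiableAt (by simp))
      (hηd s).differentiableAt.mdifferentiableAt
    have h2 : mfderiv 𝓘(ℝ, ℝ) (𝓡∂ 3) γ s 1 = ∑ i, c i • coordVec x (η s) i := by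
      rw [← mfderivWithin_symm_sum,
        mfderivWithin_of_mem_nhds (range_mem_nhds_of_mem_interior_target hmem)]
      have h3 := congr($h1 1)
      rw [mfderiv_eq_fderiv] at h3
      refine h3.trans ?_
      change mfderiv _ _ _ _ (fderiv ℝ η s 1) = _
      rw [fderiv_apply_one_eq_deriv, (hηd s).deriv]
    rw [h2, ← ofReal_norm]
    exact ENNReal.ofReal_le_ofReal (hball hs).2.le
  have hdist : ∀ a b : ℝ, |a| < ε → |b| < ε → a ≤ b → dist (γ a) (γ b) ≤ m * (b - a) := by
    intro a b ha hb hab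
    have hsub : ∀ s ∈ Icc a b, |s| < ε := fun s hs ↦
      abs_lt.2 ⟨(abs_lt.1 ha).1.trans_le hs.1, hs.2.trans_lt (abs_lt.1 hb).2⟩
    have h1 := edist_le_pathELength hab (γ := γ) fun s hs ↦
      ((hγd s (hsub s hs)).of_le (by simp)).contMDiffWithinAt
    have h2 : Manifold.pathELength (𝓡∂ 3) γ a b ≤ ENNReal.ofReal (m * (b - a)) := by
      rw [Manifold.pathELength_eq_lintegral_mfderiv_Icc, ENNReal.ofReal_mul hm0]
      refine (setLIntegral_mono' measurableSet_Icc fun s hs ↦ hγn s (hsub s hs)).trans ?_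
      simp
    have := h1.trans h2
    rw [edist_dist] at this
    exact (ENNReal.ofReal_le_ofReal_iff (mul_nonneg hm0 (sub_nonneg.2 hab))).1 this
  have hderiv : HasDerivAt (fun s ↦ f (γ s))
      (differential f ((extChartAt (𝓡∂ 3) x).symm u) (∑ i, c i • coordVec x u i)) 0 := by
    have hch := (contDiffAt_inChart_of_mem hu hd).differentiableAt (by simp)
    rw [← hη0] at hch
    have := hch.hasFDerivAt.comp_hasDerivAt 0 (hηd 0)
    have e : fderiv ℝ (inChart x f) (η 0) V = differential f
        ((extChartAt (𝓡∂ 3) x).symm u) (∑ i, c i • coordVec x u i) := by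
      rw [hη0, hV, map_sum]
      refine Eq.trans (Finset.sum_congr rfl fun i _ ↦ ?_) (map_sum _ _ _).symm
      rw [map_smul, ← pderiv_eq_fderiv (range_mem_nhds_of_mem_interior_target hu),
        pderiv_inChart (interior_subset hu) (hd.mdifferentiableAt (by simp))]
      exact (map_smul _ _ _).symm
    rw [e] at this
    exact this
  have hfd : ∀ a b : M, |f a - f b| ≤ dist a b := fun a b ↦ by
    simpa [Real.dist_eq] using hf.dist_le_mul a b
  refine hderiv.le_of_lip' hm0 ?_
  have hε0 : ∀ᶠ s in 𝓝 (0 : ℝ), |s| < ε := by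
    filter_upwards [Metric.ball_mem_nhds 0 hε] with s hs
    simpa [Real.dist_eq] using hs
  filter_upwards [hε0] with s hs
  have h0 : |(0 : ℝ)| < ε := by simpa using hε
  rw [Real.norm_eq_abs, Real.norm_eq_abs]
  refine (hfd _ _).trans ?_
  rcases le_total s 0 with hs0 | hs0
  · exact (hdist s 0 hs h0 hs0).trans_eq (by rw [sub_zero, abs_of_nonpos hs0]; ring)
  · rw [dist_comm]
    exact (hdist 0 s h0 hs hs0).trans_eq (by rw [sub_zero, abs_of_nonneg hs0])

end Eikonal



/-! ### Smoothness of matrix inverses and the contracted Hessian. -/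

section MatrixCalculus

lemma contDiffAt_det {E ι : Type*} [NormedAddCommGroup E] [NormedSpace ℝ E] [Fintype ι]
    [DecidableEq ι] {n : WithTop ℕ∞} {A : E → Matrix ι ι ℝ} {u : E}
    (hA : ∀ i j, ContDiffAt ℝ n (fun v ↦ A v i j) u) : ContDiffAt ℝ n (fun v ↦ (A v).det) u := by
  simp only [Matrix.det_apply]
  exact ContDiffAt.sum fun σ _ ↦ (contDiffAt_prod fun i _ ↦ hA _ _).const_smul _

lemma contDiffAt_matrix_inv {E ι : Type*} [NormedAddCommGroup E] [NormedSpace ℝ E] [Fintype ι]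
    [DecidableEq ι] {n : WithTop ℕ∞} {A : E → Matrix ι ι ℝ} {u : E}
    (hA : ∀ i j, ContDiffAt ℝ n (fun v ↦ A v i j) u) (hdet : (A u).det ≠ 0) (i j : ι) :
    ContDiffAt ℝ n (fun v ↦ (A v)⁻¹ i j) u := by
  simp only [Matrix.inv_def, Ring.inverse_eq_inv', Matrix.smul_apply, smul_eq_mul,
    Matrix.adjugate_apply]
  refine ((contDiffAt_det hA).inv hdet).mul (contDiffAt_det fun a b ↦ ?_)
  simp only [Matrix.updateRow_apply]
  split_ifs
  · exact contDiffAt_const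
  · exact hA a b

/-- `N` stands for the gradient, `t` for the differential, `S` for second partials and `D a i j` for
`∂ₐ gᵢⱼ`. Contracted twice with `N`, two of the three Christoffel terms cancel, and `hS`, the
differentiated eikonal equation, contracted with `N` cancels the rest. -/
lemma hess_contraction (N t : Fin 3 → ℝ) (P S : Fin 3 → Fin 3 → ℝ) (D : Fin 3 → Fin 3 → Fin 3 → ℝ)
    (hS : ∀ a, 2 * ∑ k, N k * S a k = ∑ k, ∑ j, N k * N j * D a k j)
    (hN : ∀ p, ∑ m, P m p * t m = N p) :
    ∑ i, ∑ j, N i * N j *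
      (S i j - ∑ m, (1 / 2 * ∑ p, P m p * (D i j p + D j i p - D p i j)) * t m) = 0 := by
  have h : ∀ E : Fin 3 → ℝ, ∑ m, (1 / 2 * ∑ p, P m p * E p) * t m = 1 / 2 * ∑ p, N p * E p := by
    intro E
    simp only [← hN, Finset.sum_mul, Finset.mul_sum]
    rw [Finset.sum_comm]
    exact Finset.sum_congr rfl fun i _ ↦ Finset.sum_congr rfl fun j _ ↦ by ring
  simp only [h]
  simp only [Fin.sum_univ_three] at hS ⊢
  linear_combination (1 / 2) * (N 0 * hS 0 + N 1 * hS 1 + N 2 * hS 2)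

end MatrixCalculus

/-! ### The eikonal equation and its derivative. -/

section Eikonal

variable {M : Type*} [MetricSpace M] [ChartedSpace (EuclideanHalfSpace 3) M]
  [Bundle.RiemannianBundle (fun x : M ↦ TangentSpace (𝓡∂ 3) x)]
  [IsManifold (𝓡∂ 3) ∞ M]
  [IsContMDiffRiemannianBundle (𝓡∂ 3) ∞ E3 (fun x : M ↦ TangentSpace (𝓡∂ 3) x)]

lemma contDiffAt_inv_metricMat {x : M} {u : E3}
    (hu : u ∈ interior (extChartAt (𝓡∂ 3) x).target) (i j : Fin 3) :
    ContDiffAt ℝ ∞ (fun v ↦ (metricMat x v)⁻¹ i j) u :=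
  contDiffAt_matrix_inv (contDiffAt_metricMat hu) (posDef_metricMat (interior_subset hu)).det_pos.ne'
    i j

/-- The components of the gradient in the preferred chart at `x`, as functions of the
coordinates. -/
noncomputable def chartGrad (x : M) (f : M → ℝ) (i : Fin 3) (u : E3) : ℝ :=
  ∑ j, (metricMat x u)⁻¹ i j * pderiv j (inChart x f) u

lemma chartGradSq_eq_sum (x : M) (f : M → ℝ) (u : E3) :
    chartGradSq x f u = ∑ i, chartGrad x f i u * pderiv i (inChart x f) u := by
  simp only [chartGradSq, chartGrad, Finset.sum_mul]

lemma sum_metricMat_mul_chartGrad {x : M} {u : E3} (hu : u ∈ (extChartAt (𝓡∂ 3) x).target)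
    (f : M → ℝ) (i : Fin 3) :
    ∑ j, metricMat x u i j * chartGrad x f j u = pderiv i (inChart x f) u := by
  have h : (metricMat x u).mulVec ((metricMat x u)⁻¹.mulVec fun j ↦ pderiv j (inChart x f) u)
      = fun j ↦ pderiv j (inChart x f) u := by
    rw [Matrix.mulVec_mulVec, Matrix.mul_nonsing_inv _ (posDef_metricMat hu).det_pos.ne'.isUnit,
      Matrix.one_mulVec]
  exact congr_fun h i

lemma contDiffAt_chartGrad {x : M} {u : E3}
    (hu : u ∈ interior (extChartAt (𝓡∂ 3) x).target) {f : M → ℝ}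
    (hf : ContMDiffAt (𝓡∂ 3) 𝓘(ℝ, ℝ) ∞ f ((extChartAt (𝓡∂ 3) x).symm u)) (i : Fin 3) :
    ContDiffAt ℝ ∞ (chartGrad x f i) u :=
  ContDiffAt.sum fun j _ ↦ (contDiffAt_inv_metricMat hu i j).mul
    (contDiffAt_pderiv (range_mem_nhds_of_mem_interior_target hu) (contDiffAt_inChart_of_mem hu hf)
      (by simp) j)

variable [IsRiemannianManifold (𝓡∂ 3) M]

/-- The eikonal equation `|∇τ|² = 1` in the collar. -/
lemma chartGradSq_tau {T : ℝ} (hT : IsCollarWidth M T) {x : M} {u : E3}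
    (hu : u ∈ interior (extChartAt (𝓡∂ 3) x).target)
    (h0 : 0 < tau ((extChartAt (𝓡∂ 3) x).symm u)) (h1 : tau ((extChartAt (𝓡∂ 3) x).symm u) < T) :
    chartGradSq x tau u = 1 := by
  have hs := contMDiffAt_tau hT h1
  have hut := interior_subset hu
  refine le_antisymm ?_ ?_
  · obtain ⟨w, -, hw, hw2⟩ := exists_gradient hut (hs.mdifferentiableAt (by simp))
    have h := abs_differential_le_of_lipschitz lipschitzWith_tau hu hs w
    -- Testing the bound on the gradient itself gives `‖w‖² ≤ ‖w‖`.
    have e : differential tau ((extChartAt (𝓡∂ 3) x).symm u) w = ‖w‖ ^ 2 :=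
      (hw w).trans (real_inner_self_eq_norm_sq _)
    rw [e, abs_of_nonneg (by positivity)] at h
    rw [← hw2]
    nlinarith [norm_nonneg w]
  · by_contra! hlt
    -- By continuity `|∇τ|² < q` persists nearby, so `√q < 1` bounds `dτ` on a neighbourhood; the
    -- maximum with `0` keeps `q` nonnegative.
    obtain ⟨q, hq1, hq2⟩ := exists_between (max_lt hlt zero_lt_one)
    have hq0 : 0 ≤ q := (le_max_right _ _).trans hq1.le
    have hcont : ContinuousAt (chartGradSq x tau) u := by
      have : ContinuousAt (fun v ↦ ∑ i, chartGrad x tau i v * pderiv i (inChart x tau) v) u :=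
        tendsto_finsetSum _ fun i _ ↦ (contDiffAt_chartGrad hu hs i).continuousAt.mul
          (contDiffAt_pderiv (m := ∞) (range_mem_nhds_of_mem_interior_target hu)
            (contDiffAt_inChart_of_mem hu hs) (by simp) i).continuousAt
      exact this.congr (.of_forall fun v ↦ (chartGradSq_eq_sum x tau v).symm)
    have hlt' : ∀ᶠ v in 𝓝 u, chartGradSq x tau v < q :=
      hcont.eventually (gt_mem_nhds ((le_max_left _ _).trans_lt hq1))
    refine not_eventually_abs_differential_tau_le h0 (Real.sqrt_nonneg q)
      ((Real.sqrt_lt_sqrt hq0 hq2).trans_eq Real.sqrt_one) ?_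
    have hsrc : (extChartAt (𝓡∂ 3) x).symm u ∈ (extChartAt (𝓡∂ 3) x).source :=
      (extChartAt (𝓡∂ 3) x).map_target hut
    have hc : Filter.Tendsto (extChartAt (𝓡∂ 3) x) (𝓝 ((extChartAt (𝓡∂ 3) x).symm u)) (𝓝 u) := by
      have := continuousAt_extChartAt' (I := 𝓡∂ 3) hsrc
      rwa [ContinuousAt, (extChartAt (𝓡∂ 3) x).right_inv hut] at this
    filter_upwards [hc.eventually hlt', hc.eventually (isOpen_interior.mem_nhds hu),
      (isOpen_extChartAt_source (I := 𝓡∂ 3) x).mem_nhds hsrc,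
      (isOpen_lt continuous_tau continuous_const).mem_nhds h1] with z hz1 hz2 hz3 hz4
    refine ⟨(contMDiffAt_tau hT hz4).of_le (by simp), ?_⟩
    obtain ⟨v, hv1, hv2, rfl⟩ : ∃ v, chartGradSq x tau v < q ∧
        v ∈ interior (extChartAt (𝓡∂ 3) x).target ∧ (extChartAt (𝓡∂ 3) x).symm v = z :=
      ⟨_, hz1, hz2, (extChartAt (𝓡∂ 3) x).left_inv hz3⟩
    intro w'
    obtain ⟨w, -, hw, hw2⟩ := exists_gradient (interior_subset hv2)
      ((contMDiffAt_tau hT hz4).mdifferentiableAt (by simp))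
    have e : differential tau ((extChartAt (𝓡∂ 3) x).symm v) w' = inner ℝ w w' := hw w'
    rw [e]
    refine (abs_real_inner_le_norm _ _).trans (mul_le_mul_of_nonneg_right ?_ (norm_nonneg _))
    exact Real.le_sqrt_of_sq_le (hw2.trans_lt hv1).le

lemma gradNormSq_tau {T : ℝ} (hT : IsCollarWidth M T) {x : M} (h0 : 0 < tau x) (h1 : tau x < T) :
    gradNormSq tau x = 1 := by
  rw [gradNormSq_eq_chartGradSq]
  exact chartGradSq_tau hT (basePt_mem_interior_target (mem_interior_of_tau_pos h0))
    (by rwa [extChartAt_symm_basePt]) (by rwa [extChartAt_symm_basePt])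

/-- The Hessian of `τ` vanishes in the normal direction. -/
lemma sum_grad_grad_hess_tau {T : ℝ} (hT : IsCollarWidth M T) {x : M} (h0 : 0 < tau x)
    (h1 : tau x < T) :
    ∑ i, ∑ j, gradAt tau x i * gradAt tau x j * hessAt tau x i j = 0 := by
  have hint := mem_interior_of_tau_pos h0
  have hu := basePt_mem_interior_target hint
  have hr := range_mem_nhds_basePt hint
  have hs : ContMDiffAt (𝓡∂ 3) 𝓘(ℝ, ℝ) ∞ (tau : M → ℝ)
      ((extChartAt (𝓡∂ 3) x).symm (basePt x)) := by
    rw [extChartAt_symm_basePt]; exact contMDiffAt_tau hT h1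
  have hone : (fun v ↦ ∑ k, chartGrad x tau k v * pderiv k (inChart x tau) v)
      =ᶠ[𝓝 (basePt x)] fun _ ↦ 1 := by
    have hev : ∀ᶠ y in 𝓝 x, 0 < tau y ∧ tau y < T :=
      ((isOpen_lt continuous_const continuous_tau).inter
        (isOpen_lt continuous_tau continuous_const)).mem_nhds ⟨h0, h1⟩
    filter_upwards [isOpen_interior.mem_nhds hu, (tendsto_extChartAt_symm_basePt x).eventually hev]
      with v hv1 hv2
    rw [← chartGradSq_eq_sum]
    exact chartGradSq_tau hT hv1 hv2.1 hv2.2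
  have hN : ∀ k, DifferentiableAt ℝ (chartGrad x tau k) (basePt x) := fun k ↦
    (contDiffAt_chartGrad hu hs k).differentiableAt (by simp)
  have ht : ∀ k, DifferentiableAt ℝ (fun v ↦ pderiv k (inChart x tau) v) (basePt x) := fun k ↦
    (contDiffAt_pderiv (m := ∞) hr (contDiffAt_inChart_of_mem hu hs) (by simp) k).differentiableAt
      (by simp)
  have hG : ∀ i j, DifferentiableAt ℝ (fun v ↦ metricMat x v i j) (basePt x) := fun i j ↦
    (contDiffAt_metricMat hu i j).differentiableAt (by simp)
  refine hess_contraction (gradAt tau x) (partialAt tau x) (invMetric x) _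
    (fun a i j ↦ pderiv a (fun v ↦ metricMat x v i j) (basePt x)) (fun a ↦ ?_) (fun p ↦ ?_)
  -- Differentiating `tₖ = gₖⱼ Nʲ` instead of `Nᵏ = gᵏʲ tⱼ` avoids derivatives of the inverse
  -- metric: `e1` differentiates `Nᵏtₖ = 1`, and the unknown `∂ₐN` cancels between `e1` and `e4`.
  · have e1 : ∑ k, (gradAt tau x k * pderiv a (fun v ↦ pderiv k (inChart x tau) v) (basePt x)
        + partialAt tau x k * pderiv a (chartGrad x tau k) (basePt x)) = 0 := by
      have h2 := pderiv_congr (i := a) hr hone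
      rw [pderiv_sum hr fun k _ ↦ (hN k).fun_mul (ht k)] at h2
      simp only [pderiv_mul hr (hN _) (ht _)] at h2
      refine h2.trans ?_
      rw [pderiv_eq_fderiv hr]; simp
    have e2 : ∀ k, pderiv a (fun v ↦ pderiv k (inChart x tau) v) (basePt x)
        = ∑ j, (metricMat x (basePt x) k j * pderiv a (chartGrad x tau j) (basePt x)
          + gradAt tau x j * pderiv a (fun v ↦ metricMat x v k j) (basePt x)) := by
      intro k
      have h2 : (fun v ↦ pderiv k (inChart x tau) v) =ᶠ[𝓝 (basePt x)]
          fun v ↦ ∑ j, metricMat x v k j * chartGrad x tau j v := by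
        filter_upwards [isOpen_interior.mem_nhds hu] with v hv
        exact (sum_metricMat_mul_chartGrad (interior_subset hv) tau k).symm
      rw [pderiv_congr hr h2, pderiv_sum hr fun j _ ↦ (hG k j).fun_mul (hN j)]
      simp only [pderiv_mul hr (hG _ _) (hN _)]
      rfl
    have e3 : ∀ j, ∑ k, gradAt tau x k * metricMat x (basePt x) k j = partialAt tau x j := by
      intro j
      rw [partialAt, ← sum_metricMat_mul_chartGrad (interior_subset hu) tau j]
      exact Finset.sum_congr rfl fun k _ ↦ by rw [metricMat_symm x _ k j, mul_comm]; rfl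
    have e4 : ∑ k, gradAt tau x k * pderiv a (fun v ↦ pderiv k (inChart x tau) v) (basePt x)
        = ∑ j, partialAt tau x j * pderiv a (chartGrad x tau j) (basePt x)
          + ∑ k, ∑ j, gradAt tau x k * gradAt tau x j
            * pderiv a (fun v ↦ metricMat x v k j) (basePt x) := by
      simp only [e2, ← e3, Finset.mul_sum, Finset.sum_mul]
      rw [Finset.sum_comm (f := fun j k ↦ gradAt tau x k * metricMat x (basePt x) k j
        * pderiv a (chartGrad x tau j) (basePt x))]
      simp only [← Finset.sum_add_distrib]
      exact Finset.sum_congr rfl fun i _ ↦ Finset.sum_congr rfl fun j _ ↦ by ring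
    rw [Finset.sum_add_distrib] at e1
    linarith
  · exact Finset.sum_congr rfl fun m _ ↦ by rw [invMetric, inv_metricMat_symm]

end Eikonal



/-! ### The comparison principle. -/

section Comparison

lemma pderiv_sub {u : E3} (hu : Set.range (𝓡∂ 3) ∈ 𝓝 u) {h h' : E3 → ℝ}
    (hh : DifferentiableAt ℝ h u) (hh' : DifferentiableAt ℝ h' u) (i : Fin 3) :
    pderiv i (fun v ↦ h v - h' v) u = pderiv i h u - pderiv i h' u := by
  simp only [pderiv_eq_fderiv hu, fderiv_fun_sub hh hh']
  simp

lemma pderiv_pderiv_sub {u : E3} (hu : Set.range (𝓡∂ 3) ∈ 𝓝 u) {h h' : E3 → ℝ}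
    (hh : ContDiffAt ℝ 2 h u) (hh' : ContDiffAt ℝ 2 h' u) (i j : Fin 3) :
    pderiv i (fun v ↦ pderiv j (fun w ↦ h w - h' w) v) u
      = pderiv i (fun v ↦ pderiv j h v) u - pderiv i (fun v ↦ pderiv j h' v) u := by
  have e : (fun v ↦ pderiv j (fun w ↦ h w - h' w) v)
      =ᶠ[𝓝 u] fun v ↦ pderiv j h v - pderiv j h' v := by
    filter_upwards [eventually_range_mem_nhds hu, hh.eventually (by simp),
      hh'.eventually (by simp)] with v h1 h2 h3
    exact pderiv_sub h1 (h2.differentiableAt (by simp)) (h3.differentiableAt (by simp)) j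
  rw [pderiv_congr hu e, pderiv_sub hu]
  · exact (contDiffAt_pderiv hu hh (m := 1) (by norm_num) j).differentiableAt (by simp)
  · exact (contDiffAt_pderiv hu hh' (m := 1) (by norm_num) j).differentiableAt (by simp)

variable {M : Type*} [MetricSpace M] [ChartedSpace (EuclideanHalfSpace 3) M]
  [Bundle.RiemannianBundle (fun x : M ↦ TangentSpace (𝓡∂ 3) x)]
  [IsManifold (𝓡∂ 3) ∞ M]
  {k : ∀ x : M, TangentSpace (𝓡∂ 3) x →L[ℝ] TangentSpace (𝓡∂ 3) x →L[ℝ] ℝ}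

open Matrix in
lemma gradAt_eq_mulVec (f : M → ℝ) (x : M) : gradAt f x = invMetric x *ᵥ partialAt f x := rfl

open Matrix in
lemma gradNormSq_eq_dotProduct (f : M → ℝ) (x : M) :
    gradNormSq f x = partialAt f x ⬝ᵥ (invMetric x *ᵥ partialAt f x) := by
  rw [dotProduct_comm]; rfl

lemma gradNormSq_nonneg (f : M → ℝ) (x : M) : 0 ≤ gradNormSq f x := by
  rw [gradNormSq_eq_dotProduct]
  simpa using (posDef_invMetric x).posSemidef.dotProduct_mulVec_nonneg (partialAt f x)

/-- The comparison principle for the Jang operator at a local minimum of a difference. -/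
lemma jangOp_le_jangOp_of_isLocalMin {x : M} (hx : x ∈ (𝓡∂ 3).interior M) {φ f f' : M → ℝ}
    (hφ : 0 ≤ φ x) (hf : ContMDiffAt (𝓡∂ 3) 𝓘(ℝ, ℝ) 2 f x)
    (hf' : ContMDiffAt (𝓡∂ 3) 𝓘(ℝ, ℝ) 2 f' x) (hmin : IsLocalMin (fun y ↦ f y - f' y) x) :
    jangOp k φ f' x ≤ jangOp k φ f x := by
  have hr := range_mem_nhds_basePt hx
  have hc := contDiffAt_inChart hx hf
  have hc' := contDiffAt_inChart hx hf'
  have hmin' : IsLocalMin (fun u ↦ inChart x f u - inChart x f' u) (basePt x) := by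
    have := (tendsto_extChartAt_symm_basePt x).eventually hmin
    filter_upwards [this] with u hu
    rw [inChart_basePt, inChart_basePt]
    exact hu
  have hp : partialAt f x = partialAt f' x := by
    funext i
    have := pderiv_eq_zero_of_isLocalMin (i := i) hr hmin'
    rw [pderiv_sub hr (hc.differentiableAt (by simp)) (hc'.differentiableAt (by simp))] at this
    exact sub_eq_zero.1 this
  have hg : gradAt f x = gradAt f' x := by rw [gradAt_eq_mulVec, hp, gradAt_eq_mulVec]
  have hgn : gradNormSq f x = gradNormSq f' x := by
    rw [gradNormSq_eq_dotProduct, hp, gradNormSq_eq_dotProduct]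
  set q := gradNormSq f' x with hq
  have hq0 : 0 ≤ q := gradNormSq_nonneg f' x
  set a := φ x ^ 2 / (1 + φ x ^ 2 * q) with ha
  have hW : 0 < 1 + φ x ^ 2 * q := by positivity
  have hA := posSemidef_sub_smul_vecMulVec (posDef_invMetric x).posSemidef (partialAt f' x)
    (a := a) (by positivity) (by
      rw [← gradNormSq_eq_dotProduct, ← hq, ha, div_mul_eq_mul_div, div_le_one hW]
      linarith)
  have hD : ∀ v : Fin 3 → ℝ, 0 ≤ ∑ i, ∑ j, v i * v j * (hessAt f x i j - hessAt f' x i j) := by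
    intro v
    have := sum_pderiv_pderiv_nonneg_of_isLocalMin hr (hc.sub hc') hmin' v
    refine this.trans_eq (Finset.sum_congr rfl fun i _ ↦ Finset.sum_congr rfl fun j _ ↦ ?_)
    rw [pderiv_pderiv_sub hr hc hc', hessAt, hessAt, hp]
    ring
  have key := sum_sum_mul_nonneg_of_posSemidef hA hD
  have hs : 0 < √(1 + φ x ^ 2 * q) := Real.sqrt_pos.2 hW
  -- Equal gradients make the coefficients, the `∇φ` terms and the `k` terms cancel; only the
  -- Hessian difference survives.
  have : jangOp k φ f x - jangOp k φ f' x = φ x / √(1 + φ x ^ 2 * q) *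
      ∑ i, ∑ j, (invMetric x - a • Matrix.vecMulVec ((invMetric x).mulVec (partialAt f' x))
        ((invMetric x).mulVec (partialAt f' x))) i j * (hessAt f x i j - hessAt f' x i j) := by
    simp only [jangOp, hp, hg, hgn, ← hq, ← Finset.sum_sub_distrib, Finset.mul_sum]
    refine Finset.sum_congr rfl fun i _ ↦ Finset.sum_congr rfl fun j _ ↦ ?_
    rw [← gradAt_eq_mulVec, Matrix.sub_apply, Matrix.smul_apply, Matrix.vecMulVec_apply, ha,
      smul_eq_mul]
    field_simp
    ring
  rw [← sub_nonneg, this]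
  exact mul_nonneg (div_nonneg hφ hs.le) key

lemma contMDiffAt_comp_tau {T : ℝ} (hT : IsCollarWidth M T) {x : M} (h1 : tau x < T) {δ : ℝ}
    {ψ : ℝ → ℝ} {n : ℕ} (hψ : ContDiffAt ℝ n ψ (tau x + δ)) :
    ContMDiffAt (𝓡∂ 3) 𝓘(ℝ, ℝ) n (fun y ↦ ψ (tau y + δ)) x := by
  have h : ContDiffAt ℝ n (fun t ↦ ψ (t + δ)) (tau x) :=
    ContDiffAt.comp _ hψ (contDiffAt_id.add contDiffAt_const)
  exact h.contMDiffAt.comp x ((contMDiffAt_tau hT h1).of_le (by exact_mod_cast le_top))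

/-- If `f - ψ(τ + δ)` were negative somewhere, it would attain a local minimum strictly between the
boundary and `S_{τ₀}`, where the strict inequality for `ψ` contradicts `J(f) = 0`. -/
theorem le_of_isShiftedSubsolution {T : ℝ} (hT : IsCollarWidth M T) {φ f : M → ℝ} {ψ : ℝ → ℝ}
    {l Λ δ τ₀ : ℝ} (hφ : ∀ x ∈ (𝓡∂ 3).interior M, 0 < φ x) (hψ : ContDiffOn ℝ 2 ψ (Set.Ioi 0))
    (hΛ : 0 < Λ) (hδ : 0 < δ) (hτ₀ : τ₀ < T)
    (hsub : IsShiftedSubsolution k φ l Λ δ τ₀ ψ) (hf : IsBlowUpSolution k φ f)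
    (hbdry : ∀ x, tau x = τ₀ → ψ (τ₀ + δ) ≤ f x) {x₀ : M} (h0 : 0 < tau x₀) (h1 : tau x₀ ≤ τ₀) :
    ψ (tau x₀ + δ) ≤ f x₀ := by
  by_contra! hlt
  have hψat : ∀ x : M, ContDiffAt ℝ 2 ψ (tau x + δ) := fun x ↦
    hψ.contDiffAt (Ioi_mem_nhds (by linarith [tau_nonneg x]))
  have hψc : Continuous fun y : M ↦ ψ (tau y + δ) := continuous_iff_continuousAt.2 fun x ↦
    ContinuousAt.comp (f := fun y : M ↦ tau y + δ) (hψat x).continuousAt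
      (continuous_tau.add continuous_const).continuousAt
  set u : M → ℝ := fun y ↦ f y - ψ (tau y + δ) with hu
  have hfc : ∀ x, 0 < tau x → ContMDiffAt (𝓡∂ 3) 𝓘(ℝ, ℝ) ∞ f x := fun x hx ↦
    hf.smooth.contMDiffAt (interior_mem_nhds_of_tau_pos hx)
  have huc : ∀ x, 0 < tau x → ContinuousAt u x := fun x hx ↦
    (hfc x hx).continuousAt.sub hψc.continuousAt
  -- A sublevel set below a negative value: once closed it is compact, lying in `{τ ≤ T}`.
  set L : Set M := {x | 0 < tau x ∧ tau x ≤ τ₀ ∧ u x ≤ u x₀} with hL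
  have hLne : L.Nonempty := ⟨x₀, h0, h1, le_rfl⟩
  have hbne : ((𝓡∂ 3).boundary M).Nonempty := by
    by_contra h
    rw [Set.not_nonempty_iff_eq_empty] at h
    simp [tau, h] at h0
  have hLclosed : IsClosed L := by
    rw [← isSeqClosed_iff_isClosed]
    intro s p hs hsp
    have hpτ₀ : tau p ≤ τ₀ :=
      le_of_tendsto (continuous_tau.continuousAt.tendsto.comp hsp) (.of_forall fun n ↦ (hs n).2.1)
    rcases (tau_nonneg p).eq_or_lt with hp | hp
    -- A limit point on the boundary is impossible: `f → ∞` there, while `ψ(τ + δ)` tends to the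
    -- finite value `ψ(δ)`.
    · exfalso
      have hpb : p ∈ (𝓡∂ 3).boundary M :=
        ((isClosed_boundary M).mem_iff_infDist_zero hbne).2 hp.symm
      have hs' : Filter.Tendsto s Filter.atTop (𝓝[(𝓡∂ 3).interior M] p) :=
        tendsto_nhdsWithin_iff.2 ⟨hsp, .of_forall fun n ↦ mem_interior_of_tau_pos (hs n).1⟩
      have h2 := (hf.blowUp p hpb).comp hs'
      have h3 : Filter.Tendsto (fun n ↦ u x₀ + ψ (tau (s n) + δ)) Filter.atTop
          (𝓝 (u x₀ + ψ (tau p + δ))) :=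
        (hψc.continuousAt.tendsto.comp hsp).const_add _
      obtain ⟨n, hn1, hn2⟩ := ((h2.eventually_gt_atTop (u x₀ + ψ (tau p + δ) + 1)).and
        (h3.eventually (gt_mem_nhds (lt_add_one _)))).exists
      have h4 := (hs n).2.2
      simp only [hu, Function.comp_apply] at h4 hn1 hn2
      linarith
    · exact ⟨hp, hpτ₀, le_of_tendsto ((huc p hp).tendsto.comp hsp)
        (.of_forall fun n ↦ (hs n).2.2)⟩
  have hLc : IsCompact L :=
    hT.compact.of_isClosed_subset hLclosed fun x hx ↦ hx.2.1.trans hτ₀.le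
  obtain ⟨x, ⟨hx0, hxτ, hxu⟩, hxmin⟩ := hLc.exists_isMinOn hLne
    (fun y hy ↦ (huc y hy.1).continuousWithinAt)
  have hxlt : tau x < τ₀ := by
    refine lt_of_le_of_ne hxτ fun h ↦ ?_
    have := hbdry x h
    rw [← h] at this
    simp only [hu] at hxu
    linarith
  -- The minimum over `L` is a genuine local minimum, as `u` is larger at nearby points outside `L`.
  have hmin : IsLocalMin u x := by
    filter_upwards [((isOpen_lt continuous_const continuous_tau).inter
        (isOpen_lt continuous_tau continuous_const)).mem_nhds
        (show x ∈ {y | 0 < tau y} ∩ {y | tau y < τ₀} from ⟨hx0, hxlt⟩)] with y hy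
    by_cases hyu : u y ≤ u x₀
    · exact hxmin ⟨hy.1, hy.2.le, hyu⟩
    · exact hxu.trans (not_le.1 hyu).le
  have hint := mem_interior_of_tau_pos hx0
  have key := jangOp_le_jangOp_of_isLocalMin (k := k) hint (hφ x hint).le
    ((hfc x hx0).of_le ENat.LEInfty.out)
    (contMDiffAt_comp_tau (n := 2) hT (hxlt.trans hτ₀) (hψat x)) hmin
  rw [hf.eqn x hint] at key
  have hpos : 0 < Λ * (tau x + δ) ^ l := mul_pos hΛ (Real.rpow_pos_of_pos (by linarith) _)
  linarith [hsub x hx0 hxτ]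

end Comparison



/-! ### Local and uniform bounds for tensors and differentials. -/

section Bounds

/-- Monotonicity in `C` lets finitely many local constants be replaced by their maximum. -/
lemma _root_.IsCompact.exists_uniform_bound {X : Type*} [TopologicalSpace X] {K : Set X}
    (hK : IsCompact K) {P : ℝ → X → Prop} (hmono : ∀ {C C' x}, C ≤ C' → P C x → P C' x)
    (hloc : ∀ x ∈ K, ∃ C, ∀ᶠ y in 𝓝 x, P C y) : ∃ C, ∀ x ∈ K, P C x := by
  refine hK.induction_on (p := fun s ↦ ∃ C, ∀ x ∈ s, P C x) ⟨0, by simp⟩ ?_ ?_ ?_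
  · rintro s t hst ⟨C, hC⟩
    exact ⟨C, fun x hx ↦ hC x (hst hx)⟩
  · rintro s t ⟨C, hC⟩ ⟨C', hC'⟩
    refine ⟨max C C', fun x hx ↦ hx.elim (fun h ↦ hmono (le_max_left _ _) (hC x h))
      (fun h ↦ hmono (le_max_right _ _) (hC' x h))⟩
  · intro x hx
    obtain ⟨C, hC⟩ := hloc x hx
    exact ⟨_, mem_nhdsWithin_of_mem_nhds hC, C, fun y hy ↦ hy⟩

lemma _root_.ContinuousAt.eventually_norm_lt_add_one {X F : Type*} [TopologicalSpace X]
    [SeminormedAddCommGroup F] {g : X → F} {x : X} (hg : ContinuousAt g x) :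
    ∀ᶠ y in 𝓝 x, ‖g y‖ < ‖g x‖ + 1 :=
  hg.norm.eventually (gt_mem_nhds (lt_add_one _))

lemma _root_.ContinuousAt.exists_eventually_abs_bilinear_le {X F : Type*} [TopologicalSpace X]
    [NormedAddCommGroup F] [NormedSpace ℝ F] {g : X → F →L[ℝ] F →L[ℝ] ℝ} {x : X}
    (hg : ContinuousAt g x) :
    ∃ C, 0 ≤ C ∧ ∀ᶠ y in 𝓝 x, ∀ w, |g y w w| ≤ C * ‖w‖ ^ 2 := by
  let _ : SeminormedAddCommGroup (F →L[ℝ] ℝ) := ContinuousLinearMap.toSeminormedAddCommGroup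
  let _ : SeminormedAddCommGroup (F →L[ℝ] F →L[ℝ] ℝ) :=
    ContinuousLinearMap.toSeminormedAddCommGroup
  refine ⟨‖g x‖ + 1, by positivity, ?_⟩
  filter_upwards [hg.eventually_norm_lt_add_one] with y hy w
  calc |g y w w| ≤ ‖g y‖ * ‖w‖ * ‖w‖ := (g y).le_opNorm₂ w w
    _ ≤ (‖g x‖ + 1) * ‖w‖ * ‖w‖ := by gcongr
    _ = (‖g x‖ + 1) * ‖w‖ ^ 2 := by ring

variable {M : Type*} [MetricSpace M] [ChartedSpace (EuclideanHalfSpace 3) M]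
  [Bundle.RiemannianBundle (fun x : M ↦ TangentSpace (𝓡∂ 3) x)]
  [IsManifold (𝓡∂ 3) ∞ M]
  [IsContMDiffRiemannianBundle (𝓡∂ 3) ∞ E3 (fun x : M ↦ TangentSpace (𝓡∂ 3) x)]

variable (M) in
lemma isContinuousRiemannianBundle :
    IsContinuousRiemannianBundle E3 (fun x : M ↦ TangentSpace (𝓡∂ 3) x) := by
  obtain ⟨g, hg, h⟩ := IsContMDiffRiemannianBundle.exists_contMDiff (IB := 𝓡∂ 3) (n := ∞) (F := E3)
    (E := fun x : M ↦ TangentSpace (𝓡∂ 3) x)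
  exact ⟨g, hg.continuous, h⟩

/-- In the trivialization at `x` the tensor is continuous, hence locally bounded on the model space,
and the trivialization is locally bounded for the Riemannian norms. -/
lemma eventually_abs_bilinear_le
    {k : ∀ x : M, TangentSpace (𝓡∂ 3) x →L[ℝ] TangentSpace (𝓡∂ 3) x →L[ℝ] ℝ}
    (hk : ContMDiff (𝓡∂ 3) ((𝓡∂ 3).prod 𝓘(ℝ, E3 →L[ℝ] E3 →L[ℝ] ℝ)) ∞
      (fun x ↦ Bundle.TotalSpace.mk' (E3 →L[ℝ] E3 →L[ℝ] ℝ) x (k x))) (x : M) :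
    ∃ C, ∀ᶠ y in 𝓝 x, ∀ v : TangentSpace (𝓡∂ 3) y, |k y v v| ≤ C * ‖v‖ ^ 2 := by
  have := isContinuousRiemannianBundle M
  set e := trivializationAt E3 (fun x : M ↦ TangentSpace (𝓡∂ 3) x) x with he
  obtain ⟨C, hC0, hC⟩ := eventually_norm_trivializationAt_lt E3
    (fun x : M ↦ TangentSpace (𝓡∂ 3) x) x
  let k' : M → E3 →L[ℝ] E3 →L[ℝ] ℝ := fun y ↦
    ContinuousLinearMap.inCoordinates E3 (fun x : M ↦ TangentSpace (𝓡∂ 3) x) (E3 →L[ℝ] ℝ)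
      (fun x : M ↦ TangentSpace (𝓡∂ 3) x →L[ℝ] ℝ) x y x y (k y)
  have hk' : ContinuousAt k' x := by
    have W := hk.continuous.continuousAt (x := x)
    simp only [continuousAt_hom_bundle] at W
    exact W.2
  obtain ⟨A, hA0, hA⟩ := hk'.exists_eventually_abs_bilinear_le
  refine ⟨A * C ^ 2, ?_⟩
  filter_upwards [hC, hA,
    e.open_baseSet.mem_nhds (FiberBundle.mem_baseSet_trivializationAt' x)] with y hy1 hy2 hy v
  set w := e.continuousLinearMapAt ℝ y v with hw
  have hkw : k y v v = k' y w w := by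
    simp only [k']
    rw [inCoordinates_apply_eq₂ hy hy (Set.mem_univ _)]
    have A : e.symm y (e.linearMapAt ℝ y v) = v := by
      convert! (e.continuousLinearEquivAt ℝ _ hy).symm_apply_apply v
      simp [Bundle.Trivialization.coe_continuousLinearEquivAt_eq _ hy]
    simp [A, w, ← he]
  have hwn : ‖w‖ ≤ C * ‖v‖ :=
    ((e.continuousLinearMapAt ℝ y).le_opNorm v).trans
      (mul_le_mul_of_nonneg_right hy1.le (norm_nonneg _))
  rw [hkw]
  calc |k' y w w| ≤ A * ‖w‖ ^ 2 := hy2 w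
    _ ≤ A * (C * ‖v‖) ^ 2 := by gcongr
    _ = A * C ^ 2 * ‖v‖ ^ 2 := by ring

lemma eventually_abs_differential_le {f : M → ℝ} {x : M}
    (hf : ContMDiffAt (𝓡∂ 3) 𝓘(ℝ, ℝ) 1 f x) :
    ∃ C, ∀ᶠ y in 𝓝 x, ∀ v : TangentSpace (𝓡∂ 3) y, |differential f y v| ≤ C * ‖v‖ := by
  have := isContinuousRiemannianBundle M
  obtain ⟨C, hC0, hC⟩ := eventually_norm_trivializationAt_lt E3
    (fun x : M ↦ TangentSpace (𝓡∂ 3) x) x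
  have hD := (hf.mfderiv_const (m := 0) (zero_add _).le).continuousAt
  set D := inTangentCoordinates (𝓡∂ 3) 𝓘(ℝ, ℝ) id f (mfderiv (𝓡∂ 3) 𝓘(ℝ, ℝ) f) x with hDdef
  refine ⟨(‖D x‖ + 1) * C, ?_⟩
  filter_upwards [hC, hD.eventually_norm_lt_add_one,
    (isOpen_extChartAt_source (I := 𝓡∂ 3) x).mem_nhds (mem_extChartAt_source x)] with y hy1 hy2 hy v
  have hy' : y ∈ (chartAt (EuclideanHalfSpace 3) x).source := by rwa [extChartAt_source] at hy
  set w : E3 := (trivializationAt E3 (fun x : M ↦ TangentSpace (𝓡∂ 3) x) x).continuousLinearMapAt ℝ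
    y v with hw
  have hwe : w = mfderiv (𝓡∂ 3) 𝓘(ℝ, E3) (extChartAt (𝓡∂ 3) x) y v :=
    congr($(TangentBundle.continuousLinearMapAt_trivializationAt hy') v)
  have h1 : D y w = differential f y v := by
    rw [hDdef, inTangentCoordinates_eq_mfderiv_comp hy' (by rw [chartAt_self_eq]; trivial)]
    have h2 := congr($(mfderivWithin_extChartAt_symm_comp_mfderiv_extChartAt' hy) v)
    have h3 : mfderiv 𝓘(ℝ, ℝ) 𝓘(ℝ, ℝ) (extChartAt 𝓘(ℝ, ℝ) (f x)) (f y)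
        = ContinuousLinearMap.id ℝ ℝ := by
      rw [extChartAt_model_space_eq_id]; exact mfderiv_id
    rw [h3, hwe]
    exact congr_arg (differential f y) h2
  have hwn : ‖w‖ ≤ C * ‖v‖ :=
    (ContinuousLinearMap.le_opNorm _ v).trans
      (mul_le_mul_of_nonneg_right hy1.le (norm_nonneg _))
  rw [← h1]
  calc |D y w| ≤ ‖D y‖ * ‖w‖ := (D y).le_opNorm w
    _ ≤ (‖D x‖ + 1) * (C * ‖v‖) := by gcongr
    _ = (‖D x‖ + 1) * C * ‖v‖ := by ring

end Bounds



/-! ### Bounds for contractions with the unit normal; reduction to one variable. -/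

section Subsolution

variable {M : Type*} [MetricSpace M] [ChartedSpace (EuclideanHalfSpace 3) M]
  [Bundle.RiemannianBundle (fun x : M ↦ TangentSpace (𝓡∂ 3) x)]
  [IsManifold (𝓡∂ 3) ∞ M]
  {k : ∀ x : M, TangentSpace (𝓡∂ 3) x →L[ℝ] TangentSpace (𝓡∂ 3) x →L[ℝ] ℝ}

lemma basePt_mem_target (x : M) : basePt x ∈ (extChartAt (𝓡∂ 3) x).target :=
  mem_extChartAt_target x

lemma invMetric_symm (x : M) (i j : Fin 3) : invMetric x i j = invMetric x j i :=
  inv_metricMat_symm x _ i j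

lemma sum_sum_mul_tensorAt (k : ∀ x : M, TangentSpace (𝓡∂ 3) x →L[ℝ] TangentSpace (𝓡∂ 3) x →L[ℝ] ℝ)
    (x : M) (v : Fin 3 → ℝ) :
    ∑ i, ∑ j, v i * v j * tensorAt k x i j
      = k ((extChartAt (𝓡∂ 3) x).symm (basePt x)) (∑ i, v i • coordVec x (basePt x) i)
        (∑ i, v i • coordVec x (basePt x) i) := by
  simp only [map_sum, map_smul, sum_apply, smul_apply,
    smul_eq_mul, tensorAt, Finset.mul_sum]
  rw [Finset.sum_comm]
  exact Finset.sum_congr rfl fun i _ ↦ Finset.sum_congr rfl fun j _ ↦ by ring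

lemma norm_sq_sum_gradAt (f : M → ℝ) (x : M) :
    ‖∑ i, gradAt f x i • coordVec x (basePt x) i‖ ^ 2 = gradNormSq f x := by
  rw [← real_inner_self_eq_norm_sq]
  have := inner_sum_gram_inv (coordVec x (basePt x)) (metricMat x (basePt x)) (fun _ _ ↦ rfl)
    (posDef_metricMat (basePt_mem_target x)).det_pos.ne'.isUnit (partialAt f x) (gradAt f x)
  exact this

lemma abs_sum_grad_grad_tensorAt_le {x : M} {C : ℝ}
    (hC : ∀ v, |k ((extChartAt (𝓡∂ 3) x).symm (basePt x)) v v| ≤ C * ‖v‖ ^ 2) {f : M → ℝ}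
    (hf : gradNormSq f x = 1) :
    |∑ i, ∑ j, gradAt f x i * gradAt f x j * tensorAt k x i j| ≤ C := by
  rw [sum_sum_mul_tensorAt]
  refine (hC _).trans_eq ?_
  rw [norm_sq_sum_gradAt, hf, mul_one]

lemma posSemidef_levelInvMetric {x : M} {f : M → ℝ} (hf : gradNormSq f x = 1) :
    (Matrix.of (levelInvMetric f x)).PosSemidef := by
  have h := posSemidef_sub_smul_vecMulVec (posDef_invMetric x).posSemidef (partialAt f x)
    zero_le_one (by rw [← gradNormSq_eq_dotProduct, hf, one_mul])
  convert h using 1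
  ext i j
  simp [levelInvMetric, hf, Matrix.vecMulVec_apply, gradAt_eq_mulVec]

/-- The sum is `3 - 1 = 2`, the dimension of the level set; the cruder bound suffices. -/
lemma sum_levelInvMetric_mul_metricMat_le {x : M} {f : M → ℝ} (hf : gradNormSq f x = 1) :
    ∑ i, ∑ j, levelInvMetric f x i j * metricMat x (basePt x) i j ≤ 3 := by
  have h1 : ∑ i, ∑ j, invMetric x i j * metricMat x (basePt x) i j = 3 := by
    have : (invMetric x * metricMat x (basePt x)).trace = 3 := by
      rw [invMetric, Matrix.nonsing_inv_mul _
        (posDef_metricMat (basePt_mem_target x)).det_pos.ne'.isUnit, Matrix.trace_one]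
      simp
    rw [← this, Matrix.trace]
    refine Finset.sum_congr rfl fun i _ ↦ ?_
    rw [Matrix.diag_apply, Matrix.mul_apply]
    exact Finset.sum_congr rfl fun j _ ↦ by rw [metricMat_symm]
  have h2 : ∑ i, ∑ j, gradAt f x i * gradAt f x j * metricMat x (basePt x) i j = 1 := by
    rw [← norm_sq_sum_coordVec, norm_sq_sum_gradAt, hf]
  simp only [levelInvMetric, hf, div_one, sub_mul, Finset.sum_sub_distrib]
  linarith

/-- Pair the semidefinite level set metric with the nonnegative forms `C g - k` and `C g + k`. -/
lemma abs_sum_levelInvMetric_tensorAt_le {x : M} {C : ℝ} (hC0 : 0 ≤ C)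
    (hC : ∀ v, |k ((extChartAt (𝓡∂ 3) x).symm (basePt x)) v v| ≤ C * ‖v‖ ^ 2) {f : M → ℝ}
    (hf : gradNormSq f x = 1) :
    |∑ i, ∑ j, levelInvMetric f x i j * tensorAt k x i j| ≤ 3 * C := by
  have hG := sum_levelInvMetric_mul_metricMat_le hf
  have key : ∀ σ : ℝ, |σ| = 1 →
      0 ≤ C * (∑ i, ∑ j, levelInvMetric f x i j * metricMat x (basePt x) i j)
        - σ * ∑ i, ∑ j, levelInvMetric f x i j * tensorAt k x i j := by
    intro σ hσ
    have := sum_sum_mul_nonneg_of_posSemidef (posSemidef_levelInvMetric hf)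
      (B := fun i j ↦ C * metricMat x (basePt x) i j - σ * tensorAt k x i j) (fun v ↦ by
        have e : ∑ i, ∑ j, v i * v j * (C * metricMat x (basePt x) i j - σ * tensorAt k x i j)
            = C * (∑ i, ∑ j, v i * v j * metricMat x (basePt x) i j)
              - σ * ∑ i, ∑ j, v i * v j * tensorAt k x i j := by
          simp only [Finset.mul_sum, ← Finset.sum_sub_distrib]
          exact Finset.sum_congr rfl fun i _ ↦ Finset.sum_congr rfl fun j _ ↦ by ring
        rw [e, ← norm_sq_sum_coordVec, sum_sum_mul_tensorAt, sub_nonneg]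
        refine (le_abs_self _).trans ?_
        rw [abs_mul, hσ, one_mul]
        exact hC _)
    refine this.trans_eq ?_
    simp only [Finset.mul_sum, ← Finset.sum_sub_distrib]
    exact Finset.sum_congr rfl fun i _ ↦ Finset.sum_congr rfl fun j _ ↦ by
      rw [Matrix.of_apply]; ring
  have h1 := key 1 (by simp)
  have h2 := key (-1) (by simp)
  rw [abs_le]
  constructor <;> nlinarith

lemma abs_sum_grad_partialAt_le {x : M} {C : ℝ} {f h : M → ℝ}
    (hh : MDifferentiableAt (𝓡∂ 3) 𝓘(ℝ, ℝ) h x)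
    (hC : ∀ v, |differential h ((extChartAt (𝓡∂ 3) x).symm (basePt x)) v| ≤ C * ‖v‖)
    (hf : gradNormSq f x = 1) :
    |∑ i, gradAt f x i * partialAt h x i| ≤ C := by
  have e : ∑ i, gradAt f x i * partialAt h x i
      = differential h ((extChartAt (𝓡∂ 3) x).symm (basePt x))
        (∑ i, gradAt f x i • coordVec x (basePt x) i) := by
    rw [map_sum]
    refine Finset.sum_congr rfl fun i _ ↦ ?_
    rw [map_smul, partialAt, pderiv_inChart (basePt_mem_target x)]
    · rfl
    · rw [extChartAt_symm_basePt]; exact hh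
  have hn : ‖∑ i, gradAt f x i • coordVec x (basePt x) i‖ = 1 := by
    have := norm_sq_sum_gradAt f x
    rw [hf] at this
    exact (pow_eq_one_iff_of_nonneg (norm_nonneg _) two_ne_zero).1 this
  rw [e]
  refine (hC _).trans_eq ?_
  rw [hn, mul_one]

lemma meanCurvLevel_eq {x : M} {f : M → ℝ} (hf : gradNormSq f x = 1) :
    meanCurvLevel f x = ∑ i, ∑ j, levelInvMetric f x i j * hessAt f x i j := by
  simp [meanCurvLevel, hf]

variable [IsContMDiffRiemannianBundle (𝓡∂ 3) ∞ E3 (fun x : M ↦ TangentSpace (𝓡∂ 3) x)]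
  [IsRiemannianManifold (𝓡∂ 3) M]

/-- The Jang operator on functions of `τ`. -/
lemma jangOp_comp_tau {T : ℝ} (hT : IsCollarWidth M T) {x : M} (h0 : 0 < tau x) (h1 : tau x < T)
    (φ : M → ℝ) {δ : ℝ} {ψ : ℝ → ℝ} (hψ : ContDiffAt ℝ 2 ψ (tau x + δ)) :
    jangOp k φ (fun y ↦ ψ (tau y + δ)) x
      = φ x * deriv ψ (tau x + δ) / √(1 + φ x ^ 2 * deriv ψ (tau x + δ) ^ 2) * meanCurvLevel tau x
      + (φ x * deriv (deriv ψ) (tau x + δ)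
          + 2 * deriv ψ (tau x + δ) * ∑ i, gradAt tau x i * partialAt φ x i)
        / ((1 + φ x ^ 2 * deriv ψ (tau x + δ) ^ 2) * √(1 + φ x ^ 2 * deriv ψ (tau x + δ) ^ 2))
      - (∑ i, ∑ j, levelInvMetric tau x i j * tensorAt k x i j)
      - (∑ i, ∑ j, gradAt tau x i * gradAt tau x j * tensorAt k x i j)
        / (1 + φ x ^ 2 * deriv ψ (tau x + δ) ^ 2) := by
  have hint := mem_interior_of_tau_pos h0
  have hr := range_mem_nhds_basePt hint
  have hone := gradNormSq_tau hT h0 h1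
  have hτ : ContDiffAt ℝ 2 (inChart x tau) (basePt x) :=
    (contDiffAt_inChart hint (contMDiffAt_tau hT h1)).of_le ENat.LEInfty.out
  set ψδ : ℝ → ℝ := fun t ↦ ψ (t + δ) with hψδ
  have hd : deriv ψδ = fun t ↦ deriv ψ (t + δ) := by
    funext t; exact deriv_comp_add_const ψ δ t
  have hdd : deriv (deriv ψδ) = fun t ↦ deriv (deriv ψ) (t + δ) := by
    rw [hd]; funext t; exact deriv_comp_add_const (deriv ψ) δ t
  have hψδc : ContDiffAt ℝ 2 ψδ (inChart x tau (basePt x)) := by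
    rw [inChart_basePt]
    exact ContDiffAt.comp _ hψ (contDiffAt_id.add contDiffAt_const)
  set f : M → ℝ := fun y ↦ ψ (tau y + δ) with hf
  have hfc : inChart x f = fun u ↦ ψδ (inChart x tau u) := rfl
  set Y := deriv ψ (tau x + δ) with hY
  set Z := deriv (deriv ψ) (tau x + δ) with hZ
  have hp : ∀ i, partialAt f x i = Y * partialAt tau x i := fun i ↦ by
    rw [partialAt, hfc, pderiv_comp hr (hτ.differentiableAt (by simp))
      (hψδc.differentiableAt (by simp)), inChart_basePt, hd]
    rfl
  have hg : ∀ i, gradAt f x i = Y * gradAt tau x i := fun i ↦ by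
    simp only [gradAt, hp, Finset.mul_sum]
    exact Finset.sum_congr rfl fun j _ ↦ by ring
  have hgn : gradNormSq f x = Y ^ 2 := by
    have : gradNormSq f x = Y ^ 2 * gradNormSq tau x := by
      simp only [gradNormSq, hp, hg, Finset.mul_sum]
      exact Finset.sum_congr rfl fun j _ ↦ by ring
    rw [this, hone, mul_one]
  have hh : ∀ i j, hessAt f x i j
      = Y * hessAt tau x i j + Z * (partialAt tau x i * partialAt tau x j) := fun i j ↦ by
    have e := pderiv_pderiv_comp hr hτ hψδc i j
    rw [inChart_basePt, hdd, hd] at e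
    simp only [hessAt, hp]
    rw [hfc, e, mul_sub, Finset.mul_sum]
    have e2 : ∑ m, christoffel x m i j * (Y * partialAt tau x m)
        = ∑ m, Y * (christoffel x m i j * partialAt tau x m) :=
      Finset.sum_congr rfl fun m _ ↦ by ring
    rw [e2]
    simp only [partialAt]
    ring
  have key := jang_contraction (invMetric x) (hessAt tau x) (tensorAt k x) (gradAt tau x)
    (partialAt tau x) (partialAt φ x) (φ x) Y Z (invMetric_symm x) (fun _ ↦ rfl) hone
    (sum_grad_grad_hess_tau hT h0 h1)
  rw [meanCurvLevel_eq hone]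
  simp only [levelInvMetric, hone, div_one]
  rw [← key]
  simp only [jangOp, hg, hgn, hh, hp]

end Subsolution



/-! ### The profile and the scalar inequality. -/

section Profile

/-- The constant `a` with `ψ' = -α a t ^ (-b - (l + 1) / 2)` for the profile `ψ`. -/
noncomputable def profileSlope (b l : ℝ) : ℝ := if b = -(l - 1) / 2 then 1 else b + (l - 1) / 2

lemma profileSlope_pos {b l : ℝ} (hb : -(l - 1) / 2 ≤ b) : 0 < profileSlope b l := by
  rw [profileSlope]
  split_ifs with h
  · exact one_pos
  · have := lt_of_le_of_ne hb (Ne.symm h)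
    linarith

lemma contDiffOn_profile (b l α β : ℝ) : ContDiffOn ℝ 2 (profile b l α β) (Set.Ioi 0) := by
  unfold profile
  split_ifs with h
  · exact (contDiffOn_const.mul (Real.contDiffOn_log.mono fun t ht ↦ (ne_of_gt ht))).add
      contDiffOn_const
  · refine (contDiffOn_const.mul fun t ht ↦ ?_).add contDiffOn_const
    exact (Real.contDiffAt_rpow_const_of_ne (ne_of_gt ht)).contDiffWithinAt

lemma deriv_profile (b l α β : ℝ) {t : ℝ} (ht : 0 < t) :
    deriv (profile b l α β) t = -(α * profileSlope b l) * t ^ (-b - (l + 1) / 2) := by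
  unfold profile profileSlope
  split_ifs with h
  · have e : -b - (l + 1) / 2 = -1 := by rw [h]; ring
    rw [((Real.hasDerivAt_log ht.ne').const_mul (-α) |>.add_const β).deriv, e, Real.rpow_neg_one]
    ring
  · have e : -b - (l - 1) / 2 - 1 = -b - (l + 1) / 2 := by ring
    rw [((Real.hasDerivAt_rpow_const (p := -b - (l - 1) / 2) (Or.inl ht.ne')).const_mul α
      |>.add_const β).deriv, e]
    ring

lemma deriv_deriv_profile (b l α β : ℝ) {t : ℝ} (ht : 0 < t) :
    deriv (deriv (profile b l α β)) t
      = α * profileSlope b l * (b + (l + 1) / 2) * t ^ (-b - (l + 3) / 2) := by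
  have h : deriv (profile b l α β)
      =ᶠ[𝓝 t] fun s ↦ -(α * profileSlope b l) * s ^ (-b - (l + 1) / 2) := by
    filter_upwards [Ioi_mem_nhds ht] with s hs using deriv_profile b l α β hs
  have e : -b - (l + 1) / 2 - 1 = -b - (l + 3) / 2 := by ring
  rw [h.deriv_eq, ((Real.hasDerivAt_rpow_const (p := -b - (l + 1) / 2)
    (Or.inl ht.ne')).const_mul _).deriv, e]
  ring

/-- Here `tl = t ^ l`, `X = -φψ'`, `ν` is the normal derivative of `ϕ = φ̃`, and `Q = k(n,n)`. The
good term is at least `κ/(8tX²)`: one half of this pays for `H` and `Q`, the other half dominates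
`(Λ + c) t ^ l`. -/
lemma jang_lower_bound {t tl X κ ν ϕ H θ Q Λ c A N C : ℝ} (ht : 0 < t)
    (hX : 1 ≤ X) (hXt : X ^ 2 * (t * tl) = A ^ 2 * ϕ ^ 2) (hA : 0 < A) (hm : 0 < ϕ) (hN : ϕ ≤ N)
    (hκ : 0 < κ) (hΛ : 0 ≤ Λ + c) (hθ : θ ≤ c * tl) (hν : 4 * t * |ν| ≤ κ * ϕ)
    (hHQ : |H| + |Q| ≤ C) (hCt : 16 * C * t ≤ κ) (hAΛ : 16 * A ^ 2 * N ^ 2 * (Λ + c) ≤ κ) :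
    Λ * tl ≤ -X / √(1 + X ^ 2) * H
      + X / t * (κ - 2 * t * ν / ϕ) / ((1 + X ^ 2) * √(1 + X ^ 2)) - (θ - H) - Q / (1 + X ^ 2) := by
  have hW : 0 < 1 + X ^ 2 := by positivity
  set s := √(1 + X ^ 2) with hs
  have hs0 : 0 < s := Real.sqrt_pos.2 hW
  have hss : s ^ 2 = 1 + X ^ 2 := Real.sq_sqrt hW.le
  have hX0 : 0 < X := one_pos.trans_le hX
  have hXs : X ≤ s := Real.le_sqrt_of_sq_le (by linarith)
  have hs2X : s ≤ 2 * X := by nlinarith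
  set r := X / s with hr
  have hr1 : r ≤ 1 := (div_le_one hs0).2 hXs
  have hr2 : 1 / 2 ≤ r := by rw [hr, le_div_iff₀ hs0]; linarith
  -- Because `1 - r ≤ (1 - r)(1 + r) = 1 - r² = 1/(1 + X²)`.
  have hrW : 1 - r ≤ 1 / (1 + X ^ 2) := by
    have h1 : r ^ 2 = 1 - 1 / (1 + X ^ 2) := by rw [hr, div_pow, hss]; field_simp; ring
    nlinarith
  set w := 1 / (1 + X ^ 2) with hw
  have hw0 : 0 < w := by positivity
  have hwX : w ≤ 1 / X ^ 2 := one_div_le_one_div_of_le (by positivity) (by linarith)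
  have hwX' : 1 / (2 * X ^ 2) ≤ w := one_div_le_one_div_of_le hW (by nlinarith)
  set μ := κ - 2 * t * ν / ϕ with hμ
  have hμκ : κ / 2 ≤ μ := by
    have : 2 * t * ν / ϕ ≤ κ / 2 := by
      rw [div_le_iff₀ hm]
      nlinarith [le_abs_self ν]
    linarith
  have e : -X / s * H + X / t * μ / ((1 + X ^ 2) * s) - (θ - H) - Q / (1 + X ^ 2)
      = (1 - r) * H + r * w * (μ / t) - θ - Q * w := by
    rw [hr, hw]; field_simp; ring
  rw [e]
  have h1 : -(|H| * w) ≤ (1 - r) * H := by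
    calc -(|H| * w) ≤ -(|H| * (1 - r)) :=
          neg_le_neg (mul_le_mul_of_nonneg_left hrW (abs_nonneg H))
      _ = (1 - r) * -|H| := by ring
      _ ≤ (1 - r) * H := mul_le_mul_of_nonneg_left (neg_abs_le H) (by linarith)
  have h2 : Q * w ≤ |Q| * w := mul_le_mul_of_nonneg_right (le_abs_self Q) hw0.le
  have h3 : 1 / 2 * (1 / (2 * X ^ 2)) * (κ / 2 / t) ≤ r * w * (μ / t) := by
    gcongr
  have h4 : (|H| + |Q|) * w ≤ κ / (16 * t) * (1 / X ^ 2) := by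
    have : |H| + |Q| ≤ κ / (16 * t) := by
      rw [le_div_iff₀ (by positivity)]
      calc (|H| + |Q|) * (16 * t) ≤ C * (16 * t) :=
            mul_le_mul_of_nonneg_right hHQ (by positivity)
        _ ≤ κ := by linarith
    exact mul_le_mul this hwX hw0.le (by positivity)
  have h5 : 1 / 2 * (1 / (2 * X ^ 2)) * (κ / 2 / t) - κ / (16 * t) * (1 / X ^ 2)
      = κ / (16 * (t * X ^ 2)) := by field_simp; ring
  have h6 : (Λ + c) * tl ≤ κ / (16 * (t * X ^ 2)) := by
    rw [le_div_iff₀ (by positivity)]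
    calc (Λ + c) * tl * (16 * (t * X ^ 2)) = 16 * (X ^ 2 * (t * tl)) * (Λ + c) := by ring
      _ = 16 * A ^ 2 * ϕ ^ 2 * (Λ + c) := by rw [hXt]; ring
      _ ≤ 16 * A ^ 2 * N ^ 2 * (Λ + c) := by gcongr
      _ ≤ κ := hAΛ
  have h7 : (Λ + c) * tl + (|H| + |Q|) * w ≤ r * w * (μ / t) :=
    (add_le_add (h6.trans_eq h5.symm) h4).trans ((sub_add_cancel _ _).le.trans h3)
  linarith

end Profile

/-! ### Uniform constants in the collar and the strict subsolution. -/

section Collar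

variable {M : Type*} [MetricSpace M] [ChartedSpace (EuclideanHalfSpace 3) M]
  [Bundle.RiemannianBundle (fun x : M ↦ TangentSpace (𝓡∂ 3) x)]
  [IsManifold (𝓡∂ 3) ∞ M]
  [IsContMDiffRiemannianBundle (𝓡∂ 3) ∞ E3 (fun x : M ↦ TangentSpace (𝓡∂ 3) x)]
  {k : ∀ x : M, TangentSpace (𝓡∂ 3) x →L[ℝ] TangentSpace (𝓡∂ 3) x →L[ℝ] ℝ}

lemma isCompact_tau_le {T T' : ℝ} (hT : IsCollarWidth M T) (hT' : T' ≤ T) :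
    IsCompact {x : M | tau x ≤ T'} :=
  hT.compact.of_isClosed_subset (isClosed_le continuous_tau continuous_const)
    fun _ hx ↦ le_trans hx hT'

/-- `T' < T` leaves a compact set inside the region where `φt` is smooth and positive. -/
lemma exists_collar_bounds {T T' : ℝ} (hT : IsCollarWidth M T) (hT' : T' < T)
    (hk : ContMDiff (𝓡∂ 3) ((𝓡∂ 3).prod 𝓘(ℝ, E3 →L[ℝ] E3 →L[ℝ] ℝ)) ∞
      (fun x ↦ Bundle.TotalSpace.mk' (E3 →L[ℝ] E3 →L[ℝ] ℝ) x (k x)))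
    {φt : M → ℝ} (hφ : ContMDiffOn (𝓡∂ 3) 𝓘(ℝ, ℝ) ∞ φt {x : M | tau x < T})
    (hpos : ∀ x, tau x < T → 0 < φt x) :
    ∃ C m N : ℝ, 0 < C ∧ 0 < m ∧ 0 < N ∧ ∀ x : M, tau x ≤ T' →
      (m ≤ φt x ∧ φt x ≤ N) ∧ (∀ v : TangentSpace (𝓡∂ 3) x, |k x v v| ≤ C * ‖v‖ ^ 2) ∧
      ∀ v : TangentSpace (𝓡∂ 3) x, |differential φt x v| ≤ C * ‖v‖ := by
  have hK := isCompact_tau_le hT hT'.le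
  have hat : ∀ x : M, tau x ≤ T' → ContMDiffAt (𝓡∂ 3) 𝓘(ℝ, ℝ) ∞ φt x := fun x hx ↦
    hφ.contMDiffAt ((isOpen_lt continuous_tau continuous_const).mem_nhds (hx.trans_lt hT'))
  obtain ⟨C₁, hC₁⟩ := hK.exists_uniform_bound
    (P := fun C x ↦ ∀ v : TangentSpace (𝓡∂ 3) x, |k x v v| ≤ C * ‖v‖ ^ 2)
    (fun hCC h v ↦ (h v).trans (mul_le_mul_of_nonneg_right hCC (by positivity)))
    (fun x _ ↦ eventually_abs_bilinear_le hk x)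
  obtain ⟨C₂, hC₂⟩ := hK.exists_uniform_bound
    (P := fun C x ↦ ∀ v : TangentSpace (𝓡∂ 3) x, |differential φt x v| ≤ C * ‖v‖)
    (fun hCC h v ↦ (h v).trans (mul_le_mul_of_nonneg_right hCC (by positivity)))
    (fun x hx ↦ eventually_abs_differential_le ((hat x hx).of_le ENat.LEInfty.out))
  have hcont : ContinuousOn φt {x : M | tau x ≤ T'} := fun x hx ↦
    (hat x hx).continuousAt.continuousWithinAt
  obtain ⟨m, hm, hmb⟩ := hK.exists_forall_le' hcont fun x hx ↦ hpos x (lt_of_le_of_lt hx hT')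
  obtain ⟨N, hN⟩ := hK.bddAbove_image hcont
  refine ⟨max 1 (max C₁ C₂), m, max 1 N, by positivity, hm, by positivity, fun x hx ↦
    ⟨⟨hmb x hx, (hN (Set.mem_image_of_mem _ hx)).trans (le_max_right _ _)⟩, fun v ↦ ?_, fun v ↦ ?_⟩⟩
  · exact (hC₁ x hx v).trans (mul_le_mul_of_nonneg_right
      ((le_max_left _ _).trans (le_max_right _ _)) (by positivity))
  · exact (hC₂ x hx v).trans (mul_le_mul_of_nonneg_right
      ((le_max_right _ _).trans (le_max_right _ _)) (by positivity))

lemma partialAt_warping {T b δ : ℝ} (hT : IsCollarWidth M T) {φt φ : M → ℝ}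
    (hφt : ContMDiffOn (𝓡∂ 3) 𝓘(ℝ, ℝ) ∞ φt {x : M | tau x < T})
    (hφ : IsWarpingFactor T b φt δ φ) (hδ : 0 ≤ δ) {x : M} (h0 : 0 < tau x) (h1 : tau x < T)
    (i : Fin 3) :
    partialAt φ x i = b * (tau x + δ) ^ (b - 1) * φt x * partialAt tau x i
      + (tau x + δ) ^ b * partialAt φt x i := by
  have hint := mem_interior_of_tau_pos h0
  have hr := range_mem_nhds_basePt hint
  have hτ : DifferentiableAt ℝ (inChart x tau) (basePt x) :=
    (contDiffAt_inChart hint (contMDiffAt_tau hT h1)).differentiableAt (by simp)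
  have hφt' : DifferentiableAt ℝ (inChart x φt) (basePt x) :=
    (contDiffAt_inChart hint (hφt.contMDiffAt
      ((isOpen_lt continuous_tau continuous_const).mem_nhds h1))).differentiableAt (by simp)
  have hev : φ =ᶠ[𝓝 x] fun y ↦ (tau y + δ) ^ b * φt y := by
    filter_upwards [(isOpen_lt continuous_const continuous_tau).mem_nhds h0,
      (isOpen_lt continuous_tau continuous_const).mem_nhds h1] with y hy1 hy2
      using hφ.eq_collar y hy1 hy2
  have hd : HasDerivAt (fun t ↦ (t + δ) ^ b) (b * (tau x + δ) ^ (b - 1)) (tau x) := by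
    have := ((hasDerivAt_id (tau x)).add_const δ).rpow_const (p := b)
      (Or.inl (by simp only [id_eq]; linarith))
    simpa using this
  have hd' : DifferentiableAt ℝ (fun t ↦ (t + δ) ^ b) (inChart x tau (basePt x)) := by
    rw [inChart_basePt]; exact hd.differentiableAt
  have hp : DifferentiableAt ℝ (fun u ↦ (inChart x tau u + δ) ^ b) (basePt x) :=
    hd'.comp (basePt x) hτ
  have e : pderiv i (inChart x φ) (basePt x)
      = pderiv i (fun u ↦ (inChart x tau u + δ) ^ b * inChart x φt u) (basePt x) :=
    pderiv_congr hr (inChart_eventuallyEq hev)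
  rw [partialAt, e, pderiv_mul hr hp hφt',
    pderiv_comp (ψ := fun t ↦ (t + δ) ^ b) hr hτ hd', inChart_basePt, inChart_basePt, hd.deriv]
  simp only [partialAt]
  ring

variable [IsRiemannianManifold (𝓡∂ 3) M]

theorem exists_isShiftedSubsolution_profile {T b l c : ℝ} (hT : IsCollarWidth M T)
    (hk : ContMDiff (𝓡∂ 3) ((𝓡∂ 3).prod 𝓘(ℝ, E3 →L[ℝ] E3 →L[ℝ] ℝ)) ∞
      (fun x ↦ Bundle.TotalSpace.mk' (E3 →L[ℝ] E3 →L[ℝ] ℝ) x (k x)))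
    {φt : M → ℝ} (hφ : ContMDiffOn (𝓡∂ 3) 𝓘(ℝ, ℝ) ∞ φt {x : M | tau x < T})
    (hpos : ∀ x, tau x < T → 0 < φt x) (hl : 0 < l) (hc : 0 < c)
    (hθ : ∀ x : M, tau x < T →
      c⁻¹ * tau x ^ l ≤ thetaPlus k x ∧ thetaPlus k x ≤ c * tau x ^ l)
    (hb₁ : -(l - 1) / 2 ≤ b) (hb₂ : b < (l + 1) / 2) {Λ : ℝ} (hΛ : 0 < Λ) :
    ∃ α₀ > 0, ∀ α, 0 < α → α ≤ α₀ → ∃ t₀ > 0,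
      ∀ β δ τ₀ : ℝ, 0 ≤ δ → 0 < τ₀ → τ₀ < T → τ₀ + δ ≤ t₀ →
      ∀ φ : M → ℝ, IsWarpingFactor T b φt δ φ →
        IsShiftedSubsolution k φ l Λ δ τ₀ (profile b l α β) := by
  have hT0 := hT.pos
  obtain ⟨C, m, N, hC, hm, hN, hbd⟩ :=
    exists_collar_bounds (T' := T / 2) hT (by linarith) hk hφ hpos
  set κ := (l + 1) / 2 - b with hκdef
  have hκ : 0 < κ := by linarith
  set a := profileSlope b l with ha
  have ha0 : 0 < a := profileSlope_pos hb₁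
  -- The largest `A²` allowed by the last hypothesis of `jang_lower_bound`; this is what limits `α`.
  set q := κ / (16 * N ^ 2 * (Λ + c)) with hq
  have hq0 : 0 < q := by positivity
  refine ⟨√q / a, by positivity, fun α hα hαle ↦ ?_⟩
  set A := α * a with hA
  have hA0 : 0 < A := by positivity
  have hAq : A ^ 2 ≤ q := by
    have : A ≤ √q := by rwa [le_div_iff₀ ha0] at hαle
    calc A ^ 2 ≤ √q ^ 2 := by gcongr
      _ = q := Real.sq_sqrt hq0.le
  have hAΛ : 16 * A ^ 2 * N ^ 2 * (Λ + c) ≤ κ := by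
    rw [hq, le_div_iff₀ (by positivity)] at hAq
    linarith
  set D := c * T ^ l + 3 * C + C with hD
  have hD0 : 0 < D := by positivity
  -- In order: stay where the collar bounds hold; compare powers of `t`; force `X ≥ 1`; absorb `ν`;
  -- absorb `H` and `Q`.
  set t₀ := min (min (T / 2) 1) (min ((A * m) ^ 2) (min (κ * m / (4 * C)) (κ / (16 * D)))) with ht₀
  refine ⟨t₀, by positivity, fun β δ τ₀ hδ hτ₀ hτ₀T hτδ φ hφw x h0 hxτ ↦ ?_⟩
  set t := tau x + δ with ht
  have ht0 : 0 < t := by linarith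
  have htt₀ : t ≤ t₀ := by linarith
  have htT : t ≤ T / 2 := htt₀.trans ((min_le_left _ _).trans (min_le_left _ _))
  have ht1 : t ≤ 1 := htt₀.trans ((min_le_left _ _).trans (min_le_right _ _))
  have htA : t ≤ (A * m) ^ 2 := htt₀.trans ((min_le_right _ _).trans (min_le_left _ _))
  have htC : t ≤ κ * m / (4 * C) := htt₀.trans
    ((min_le_right _ _).trans ((min_le_right _ _).trans (min_le_left _ _)))
  have htD : t ≤ κ / (16 * D) := htt₀.trans
    ((min_le_right _ _).trans ((min_le_right _ _).trans (min_le_right _ _)))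
  have hxT' : tau x ≤ T / 2 := by linarith
  have h1 : tau x < T := by linarith
  have hx' : (extChartAt (𝓡∂ 3) x).symm (basePt x) = x := extChartAt_symm_basePt x
  obtain ⟨⟨hmx, hNx⟩, -, -⟩ := hbd x hxT'
  -- The coordinate vectors live in the tangent space at this point, which equals `x` only
  -- propositionally.
  obtain ⟨-, hkx, hφx⟩ := hbd ((extChartAt (𝓡∂ 3) x).symm (basePt x)) (by rwa [hx'])
  have hone := gradNormSq_tau hT h0 h1
  have hψ : ContDiffAt ℝ 2 (profile b l α β) t :=
    (contDiffOn_profile b l α β).contDiffAt (Ioi_mem_nhds ht0)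
  set ϕ := φt x with hϕ
  have hϕ0 : 0 < ϕ := hm.trans_le hmx
  set ν := ∑ i, gradAt tau x i * partialAt φt x i with hν
  have hνC : |ν| ≤ C := abs_sum_grad_partialAt_le
    ((hφ.contMDiffAt ((isOpen_lt continuous_tau continuous_const).mem_nhds h1)).mdifferentiableAt
      (by simp)) hφx hone
  set Q := ∑ i, ∑ j, gradAt tau x i * gradAt tau x j * tensorAt k x i j with hQ
  have hQC : |Q| ≤ C := abs_sum_grad_grad_tensorAt_le hkx hone
  set R := ∑ i, ∑ j, levelInvMetric tau x i j * tensorAt k x i j with hR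
  have hRC : |R| ≤ 3 * C := abs_sum_levelInvMetric_tensorAt_le hC.le hkx hone
  set H := meanCurvLevel tau x with hH
  have hθx := hθ x h1
  have hθeq : thetaPlus k x = H + R := rfl
  have htaul : tau x ^ l ≤ t ^ l := Real.rpow_le_rpow h0.le (by linarith) hl.le
  have htaul0 : 0 ≤ tau x ^ l := Real.rpow_nonneg h0.le _
  have hθle : H + R ≤ c * t ^ l := by
    rw [← hθeq]; exact hθx.2.trans (mul_le_mul_of_nonneg_left htaul hc.le)
  have hHD : |H| + |Q| ≤ D := by
    have hTl : tau x ^ l ≤ T ^ l := Real.rpow_le_rpow h0.le h1.le hl.le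
    have h2 : |H + R| ≤ c * T ^ l := by
      -- The lower bound on the null expansion enters only here, through its sign.
      rw [← hθeq, abs_of_nonneg (le_trans (by positivity) hθx.1)]
      exact hθx.2.trans (mul_le_mul_of_nonneg_left hTl hc.le)
    have h3 : |H| ≤ |H + R| + |R| := by
      calc |H| = |(H + R) - R| := by ring_nf
        _ ≤ |H + R| + |R| := abs_sub _ _
    linarith
  set g := t ^ (-((l + 1) / 2)) with hg
  have hg0 : 0 < g := Real.rpow_pos_of_pos ht0 _
  set X := A * ϕ * g with hX
  have hX1 : 1 ≤ X := by
    have h2 : t ^ ((l + 1) / 2) ≤ A * m := by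
      calc t ^ ((l + 1) / 2) ≤ t ^ (1 / 2 : ℝ) :=
            Real.rpow_le_rpow_of_exponent_ge ht0 ht1 (by linarith)
        _ = √t := (Real.sqrt_eq_rpow t).symm
        _ ≤ A * m := Real.sqrt_le_iff.2 ⟨by positivity, htA⟩
    have h3 : t ^ ((l + 1) / 2) * g = 1 := by
      rw [hg, ← Real.rpow_add ht0, add_neg_cancel, Real.rpow_zero]
    calc 1 = t ^ ((l + 1) / 2) * g := h3.symm
      _ ≤ A * ϕ * g := by
        gcongr
        exact h2.trans (by gcongr)
  have hXt : X ^ 2 * (t * t ^ l) = A ^ 2 * ϕ ^ 2 := by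
    have h2 : g ^ 2 * (t * t ^ l) = 1 := by
      have h3 : t * t ^ l = t ^ (l + 1) := by rw [Real.rpow_add ht0, Real.rpow_one, mul_comm]
      rw [h3, hg, sq, ← Real.rpow_add ht0, ← Real.rpow_add ht0]
      ring_nf
      exact Real.rpow_zero t
    rw [hX, mul_pow, mul_assoc, h2, mul_one, mul_pow]
  have hφx' : φ x = t ^ b * ϕ := hφw.eq_collar x h0 h1
  have hFy : φ x * deriv (profile b l α β) t = -X := by
    have h2 : t ^ b * t ^ (-b - (l + 1) / 2) = g := by
      rw [← Real.rpow_add ht0, hg]; congr 1; ring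
    rw [hφx', deriv_profile b l α β ht0, hX, ← h2, ← ha, hA]
    ring
  -- The exponent gives `b + (l+1)/2` from `ψ''` and `-2b` from `∂ₙφ`, whose sum is `κ`.
  have hFyz : φ x * deriv (deriv (profile b l α β)) t
      + 2 * deriv (profile b l α β) t * ∑ i, gradAt tau x i * partialAt φ x i
      = X / t * (κ - 2 * t * ν / ϕ) := by
    have h2 : t ^ b * t ^ (-b - (l + 1) / 2) = g := by
      rw [← Real.rpow_add ht0, hg]; congr 1; ring
    have h3 : t ^ b * t ^ (-b - (l + 3) / 2) = g / t := by
      rw [← Real.rpow_add ht0, hg, ← Real.rpow_sub_one ht0.ne']; congr 1; ring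
    have h4 : t ^ (b - 1) = t ^ b / t := Real.rpow_sub_one ht0.ne' b
    have h5 : ∑ i, gradAt tau x i * partialAt φ x i = b * (t ^ b / t) * ϕ + t ^ b * ν := by
      have h6 : ∑ i, gradAt tau x i * partialAt tau x i = 1 := hone
      simp only [partialAt_warping hT hφ hφw hδ h0 h1, ← ht, h4]
      calc _ = ∑ i, (b * (t ^ b / t) * ϕ * (gradAt tau x i * partialAt tau x i)
            + t ^ b * (gradAt tau x i * partialAt φt x i)) :=
            Finset.sum_congr rfl fun i _ ↦ by ring
        _ = _ := by rw [Finset.sum_add_distrib, ← Finset.mul_sum, ← Finset.mul_sum, h6, mul_one]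
    rw [hφx', h5, deriv_profile b l α β ht0, deriv_deriv_profile b l α β ht0, ← ha, ← hA]
    calc _ = A * (b + (l + 1) / 2) * ϕ * (t ^ b * t ^ (-b - (l + 3) / 2))
          - 2 * A * (t ^ b * t ^ (-b - (l + 1) / 2)) * (b * ϕ / t + ν) := by ring
      _ = _ := by rw [h2, h3, hX, hκdef]; field_simp; ring
  rw [jangOp_comp_tau hT h0 h1 φ hψ]
  have hsq : φ x ^ 2 * deriv (profile b l α β) t ^ 2 = X ^ 2 := by rw [← mul_pow, hFy, neg_sq]
  rw [← ht, hsq, hFyz, hFy]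
  have key := jang_lower_bound (θ := H + R) ht0 hX1 hXt hA0 hϕ0 hNx hκ
    (by positivity) hθle (ν := ν) (by
      rw [le_div_iff₀ (by positivity)] at htC
      calc 4 * t * |ν| ≤ 4 * t * C := by gcongr
        _ ≤ κ * m := by linarith
        _ ≤ κ * ϕ := by gcongr) hHD (by
      rw [le_div_iff₀ (by positivity)] at htD
      linarith) hAΛ
  rwa [add_sub_cancel_left] at key

end Collar

end Jang

/-! ### The subsolution and the comparison principle combined. -/

theorem proposition6p2 {M : Type*} [MetricSpace M] [ChartedSpace (EuclideanHalfSpace 3) M]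
    [IsManifold (𝓡∂ 3) ∞ M]
    [Bundle.RiemannianBundle (fun x : M ↦ TangentSpace (𝓡∂ 3) x)]
    [IsContMDiffRiemannianBundle (𝓡∂ 3) ∞ Jang.E3 (fun x : M ↦ TangentSpace (𝓡∂ 3) x)]
    [IsRiemannianManifold (𝓡∂ 3) M]
    (k : ∀ x : M, TangentSpace (𝓡∂ 3) x →L[ℝ] TangentSpace (𝓡∂ 3) x →L[ℝ] ℝ)
    (k_symm : ∀ x v w, k x v w = k x w v)
    (k_smooth : ContMDiff (𝓡∂ 3) ((𝓡∂ 3).prod 𝓘(ℝ, Jang.E3 →L[ℝ] Jang.E3 →L[ℝ] ℝ)) ∞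
      (fun x ↦ Bundle.TotalSpace.mk' (Jang.E3 →L[ℝ] Jang.E3 →L[ℝ] ℝ) x (k x)))
    (T : ℝ) (hT : Jang.IsCollarWidth M T)
    (φt : M → ℝ)
    (φt_smooth : ContMDiffOn (𝓡∂ 3) 𝓘(ℝ, ℝ) ∞ φt {x : M | Jang.tau x < T})
    (φt_pos : ∀ x, Jang.tau x < T → 0 < φt x)
    (b l c : ℝ) (hl : 0 < l) (hc : 0 < c)
    (hθ : ∀ x : M, Jang.tau x < T →
      c⁻¹ * Jang.tau x ^ l ≤ Jang.thetaPlus k x ∧ Jang.thetaPlus k x ≤ c * Jang.tau x ^ l)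
    (hb₁ : -(l - 1) / 2 ≤ b) (hb₂ : b < (l + 1) / 2) :
    (∀ Λ > 0, ∃ α₀ > 0, ∀ α, 0 < α → α ≤ α₀ → ∃ t₀ > 0,
      ∀ β δ τ₀ : ℝ, 0 ≤ δ → 0 < τ₀ → τ₀ < T → τ₀ + δ ≤ t₀ →
      ∀ φ : M → ℝ, Jang.IsWarpingFactor T b φt δ φ →
        Jang.IsShiftedSubsolution k φ l Λ δ τ₀ (Jang.profile b l α β) ∧
        (0 < δ → ∀ f : M → ℝ, Jang.IsBlowUpSolution k φ f →
          (∀ x, Jang.tau x = τ₀ → Jang.profile b l α β (τ₀ + δ) ≤ f x) →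
          ∀ x, 0 < Jang.tau x → Jang.tau x ≤ τ₀ →
            Jang.profile b l α β (Jang.tau x + δ) ≤ f x)) ∧
    (∀ ψ : ℝ → ℝ, ContDiffOn ℝ 2 ψ (Set.Ioi 0) →
      ∀ Λ δ τ₀ : ℝ, 0 < Λ → 0 < δ → 0 < τ₀ → τ₀ < T →
      ∀ φ : M → ℝ, Jang.IsWarpingFactor T b φt δ φ →
        Jang.IsShiftedSubsolution k φ l Λ δ τ₀ ψ →
        ∀ f : M → ℝ, Jang.IsBlowUpSolution k φ f →
          (∀ x, Jang.tau x = τ₀ → ψ (τ₀ + δ) ≤ f x) →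
          ∀ x, 0 < Jang.tau x → Jang.tau x ≤ τ₀ → ψ (Jang.tau x + δ) ≤ f x) := by
  refine ⟨fun Λ hΛ ↦ ?_, fun ψ hψ Λ δ τ₀ hΛ hδ _ hτ₀T φ hφ hsub f hf hbd x h0 h1 ↦
    Jang.le_of_isShiftedSubsolution hT hφ.pos hψ hΛ hδ hτ₀T hsub hf hbd h0 h1⟩
  obtain ⟨α₀, hα₀, H⟩ := Jang.exists_isShiftedSubsolution_profile hT k_smooth φt_smooth φt_pos
    hl hc hθ hb₁ hb₂ hΛ
  refine ⟨α₀, hα₀, fun α hα hαle ↦ ?_⟩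
  obtain ⟨t₀, ht₀, H'⟩ := H α hα hαle
  refine ⟨t₀, ht₀, fun β δ τ₀ hδ hτ₀ hτ₀T hle φ hφ ↦ ?_⟩
  have hsub := H' β δ τ₀ hδ hτ₀ hτ₀T hle φ hφ
  exact ⟨hsub, fun hδ' f hf hbd x h0 h1 ↦ Jang.le_of_isShiftedSubsolution hT hφ.pos
    (Jang.contDiffOn_profile b l α β) hΛ hδ' hτ₀T hsub hf hbd h0 h1⟩
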